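/- Let $C>0$. There is a constant $B>0$ depending only on $C$ such that the following holds in every dimension $d\ge 1$. Let $\sigma>0$, $\theta\in\mathbb R^d$ and ${\bm X}=\theta+{\bm Y}$, where the random vector ${\bm Y}$ in $\mathbb R^d$ has independent coordinates, mean zero, covariance matrix $\sigma^2\mathrm{Id}$, and a density $e^{-\phi}$ with $\phi:\mathbb R^d\to\mathbb R$ strongly convex. Suppose that $C$ is a sub-Gaussian scaling constant of ${\bm Y}$: for some $a>0$, $P(\|{\bm Y}\|\ge t)\le a\,e^{-t^2/C}$ for all $t>0$. Put $I=[0,\sqrt{C\log d}]$ and let $S_\lambda$ be coordinatewise soft thresholding, $(S_\lambda(x))_i=\operatorname{sgn}(x_i)(|x_i|-\lambda)_+$. Let $\nu$ be the law of ${\bm Y}$, and let $W^{1,2}(\nu)$ be the space of vector fields $f:\mathbb R^d\to\mathbb R^d$ in $L^2(\nu)$ with weak Jacobian $\nabla f=(\partial_jf_i)_{i,j}$ in $L^2(\nu)$. Let $T$ be a Stein kernel of ${\bm Y}$, i.e. a matrix-valued function with entries in $L^2(\nu)$ and $E\langle {\bm Y},f({\bm Y})\rangle=E\langle T({\bm Y}),\nabla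 f({\bm Y})\rangle$ (Hilbert–Schmidt product on the right) for all $f\in W^{1,2}(\nu)$. Let $L\ge0$ be a constant with $\max_i|\sigma^2-T_{ii}({\bm Y})|\le L$ almost surely, let $A=\max_i|\theta_i|$, and let $$M=\sup_{\lambda\in I,\;1\le i\le d}\frac{P(|X_i|>\lambda)}{P(|X_i|>\lambda+A+1)} .$$ Assume $LM<1/2$. Let $\hat\lambda$ be a random variable which almost surely minimises over $\lambda\in I$ Stein's unbiased risk estimate $$\mathrm{SURE}(\lambda)=d\sigma^2+\sum_{i=1}^d\min\{X_i^2,\lambda^2\}-2\sigma^2\,\mathrm{Card}\{i:|X_i|\le\lambda\}.$$ Then $E\|S_{\hat\lambda}({\bm X})-\theta\|^2$ and all the risks $E\|S_{\lambda}({\bm X})-\theta\|^2$, $\lambda\in I$, are finite, the minimum below is attained, and $$(1-2LM)\,E\|S_{\hat\lambda}({\bm X})-\theta\|^2\le(1+2LM)\min_{\lambda\in I}E\|S_\lambda({\bm X})-\theta\|^2+B\sqrt{d\log^3 d}.$$ -/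

import Mathlib

open MeasureTheory ProbabilityTheory

/-- `IsWeakPartial j u v`: the function `v` is the weak (distributional) partial derivative of `u`
with respect to the `j`-th coordinate on `ℝ^d`, tested against smooth compactly supported
functions. -/
def IsWeakPartial {d : ℕ} (j : Fin d) (u v : EuclideanSpace ℝ (Fin d) → ℝ) : Prop :=
  LocallyIntegrable u volume ∧ LocallyIntegrable v volume ∧
    ∀ ψ : EuclideanSpace ℝ (Fin d) → ℝ, ContDiff ℝ (⊤ : ℕ∞) ψ → HasCompactSupport ψ →
      ∫ x, u x * fderiv ℝ ψ x (EuclideanSpace.single j 1) = - ∫ x, v x * ψ x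

/-- `IsSobolev ν f J`: the vector field `f` belongs to the weighted Sobolev space `W^{1,2}(ν)` and
its (weak) Jacobian is `J`, with `J x i j = ∂_j f_i (x)`; both `f` and `J` are in `L²(ν)`. -/
def IsSobolev {d : ℕ} (ν : Measure (EuclideanSpace ℝ (Fin d)))
    (f : EuclideanSpace ℝ (Fin d) → EuclideanSpace ℝ (Fin d))
    (J : EuclideanSpace ℝ (Fin d) → Matrix (Fin d) (Fin d) ℝ) : Prop :=
  MemLp f 2 ν ∧ (∀ i j, MemLp (fun x => J x i j) 2 ν) ∧
    ∀ i j, IsWeakPartial j (fun x => f x i) (fun x => J x i j)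

/-- `T` is a Stein kernel (with finite second moment) of the centred law `ν` on `ℝ^d`:
`E⟨Y, f(Y)⟩ = E⟨T(Y), ∇f(Y)⟩` for `Y ∼ ν` and all `f ∈ W^{1,2}(ν)`, where the right-hand side is
the Hilbert-Schmidt scalar product of matrices. -/
def IsSteinKernel {d : ℕ} (ν : Measure (EuclideanSpace ℝ (Fin d)))
    (T : EuclideanSpace ℝ (Fin d) → Matrix (Fin d) (Fin d) ℝ) : Prop :=
  (∀ i j, MemLp (fun y => T y i j) 2 ν) ∧
    ∀ f J, IsSobolev ν f J →
      ∫ y, inner ℝ y (f y) ∂ν = ∫ y, ∑ i, ∑ j, T y i j * J y i j ∂ν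

/-- A law on `ℝ^d` with a positive strongly log-concave density: the density with respect to
Lebesgue measure is `exp (-φ)` with `φ : ℝ^d → ℝ` strongly convex. -/
def IsStronglyLogConcave {d : ℕ} (ν : Measure (EuclideanSpace ℝ (Fin d))) : Prop :=
  ∃ m : ℝ, 0 < m ∧ ∃ φ : EuclideanSpace ℝ (Fin d) → ℝ, StrongConvexOn Set.univ m φ ∧
    ν = volume.withDensity (fun x => ENNReal.ofReal (Real.exp (-φ x)))

/-- Soft thresholding of every coordinate at level `l`: `sgn(x_i) (|x_i| - l)_+`. -/
noncomputable def softThreshold {d : ℕ} (l : ℝ) (x : EuclideanSpace ℝ (Fin d)) :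
    EuclideanSpace ℝ (Fin d) :=
  WithLp.toLp 2 (fun i => Real.sign (x i) * max (|x i| - l) 0)

/-- The displacement `f_l(x) = S_l(x) - x` of soft thresholding. -/
noncomputable def softDisplacement {d : ℕ} (l : ℝ) (x : EuclideanSpace ℝ (Fin d)) :
    EuclideanSpace ℝ (Fin d) :=
  softThreshold l x - x

/-- The Jacobian of `softDisplacement l`, in the version
`∂_j (f_l)_i (x) = - δ_ij 1{|x_i| ≤ l}`. -/
noncomputable def softJacobian {d : ℕ} (l : ℝ) (x : EuclideanSpace ℝ (Fin d)) :
    Matrix (Fin d) (Fin d) ℝ :=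
  Matrix.diagonal (fun i => if |x i| ≤ l then -1 else 0)

/-- Stein's unbiased risk estimate, `d σ² + ‖f(x)‖² + 2 σ² div f(x)`, of the estimator `x + f(x)`
under noise with covariance `σ² Id`; `J` is the Jacobian of `f`. -/
noncomputable def sure {d : ℕ} (σ : ℝ)
    (f : EuclideanSpace ℝ (Fin d) → EuclideanSpace ℝ (Fin d))
    (J : EuclideanSpace ℝ (Fin d) → Matrix (Fin d) (Fin d) ℝ)
    (x : EuclideanSpace ℝ (Fin d)) : ℝ :=
  d * σ ^ 2 + ‖f x‖ ^ 2 + 2 * σ ^ 2 * (J x).trace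

/-- SURE for soft thresholding at level `l`. -/
noncomputable def softSure {d : ℕ} (σ l : ℝ) (x : EuclideanSpace ℝ (Fin d)) : ℝ :=
  sure σ (softDisplacement l) (softJacobian l) x

/-- The usual closed form of SURE for soft thresholding. -/
theorem softSure_eq {d : ℕ} (σ l : ℝ) (hl : 0 ≤ l) (x : EuclideanSpace ℝ (Fin d)) :
    softSure σ l x = d * σ ^ 2 + ∑ i, min (x i ^ 2) (l ^ 2)
      - 2 * σ ^ 2 * ((Finset.univ.filter (fun i => |x i| ≤ l)).card : ℝ) := by
  have h1 : ‖softDisplacement l x‖ ^ 2 = ∑ i, min (x i ^ 2) (l ^ 2) := by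
    rw [EuclideanSpace.norm_sq_eq]
    refine Finset.sum_congr rfl fun i _ => ?_
    have : softDisplacement l x i = Real.sign (x i) * max (|x i| - l) 0 - x i := rfl
    rw [this, Real.norm_eq_abs, sq_abs]
    rcases le_or_gt (|x i|) l with h | h
    · rw [max_eq_right (by linarith), min_eq_left (sq_le_sq' (by linarith [neg_abs_le (x i)])
        ((le_abs_self _).trans h))]
      ring
    · have h2 : l ^ 2 ≤ x i ^ 2 := by
        rw [← sq_abs (x i)]; exact pow_le_pow_left₀ hl h.le 2
      rw [max_eq_left (by linarith), min_eq_right h2]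
      rcases lt_trichotomy (x i) 0 with h0 | h0 | h0
      · rw [Real.sign_of_neg h0, abs_of_neg h0]; ring
      · rw [h0, abs_zero] at h; linarith
      · rw [Real.sign_of_pos h0, abs_of_pos h0]; ring
  have h2 : (softJacobian l x).trace =
      - ((Finset.univ.filter (fun i => |x i| ≤ l)).card : ℝ) := by
    simp [softJacobian, Matrix.trace, Finset.sum_ite]
  rw [softSure, sure, h1, h2]; ring

/-- The range `I = [0, √(C log d)]` of thresholds. -/
noncomputable def thresholdRange (C : ℝ) (d : ℕ) : Set ℝ :=
  Set.Icc 0 (Real.sqrt (C * Real.log d))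

/-- The tail ratios `P(|X_i| > l) / P(|X_i| > l + A + 1)`, `l ∈ I`, `1 ≤ i ≤ d`, where
`A = max_i |θ_i|`. -/
noncomputable def tailRatios {Ω : Type*} [MeasurableSpace Ω] {d : ℕ} (P : Measure Ω) (C : ℝ)
    (θ : EuclideanSpace ℝ (Fin d)) (X : Ω → EuclideanSpace ℝ (Fin d)) : Set ℝ :=
  {r | ∃ l ∈ thresholdRange C d, ∃ i : Fin d,
    r = P.real {ω | l < |X ω i|} / P.real {ω | l + (⨆ k, |θ k|) + 1 < |X ω i|}}

/-- The squared loss `‖S_l(x) - θ‖²` of soft thresholding at level `l`. -/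
noncomputable def softLoss {d : ℕ} (θ : EuclideanSpace ℝ (Fin d)) (l : ℝ)
    (x : EuclideanSpace ℝ (Fin d)) : ℝ :=
  ‖softThreshold l x - θ‖ ^ 2

/-! Write `x_i = θ_i + y_i` and let `clip l` be truncation to `[-l, l]`, so that soft thresholding
is `x - clip l x`. The loss is `Σ y_i² - 2 Σ y_i clip l x_i + Σ min(x_i², l²)`, while SURE replaces
`y_i²` by `σ²` and `y_i clip l x_i` by `σ² 1{|x_i| ≤ l}`. The proof compares both with their means,
uniformly in `l`.

Bias. The Stein identity turns `E y_i clip l x_i` into `E T_ii 1{|x_i| ≤ l}`. As `E T_ii = σ²`, the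
discrepancy lives on `{|x_i| > l}` and is at most `L P(|x_i| > l)`
(`IsSteinKernel.abs_clip_bias_le`). The ratio `M` pushes the tail out to `l + A + 1`, where the
coordinate loss is at least 1. Hence the bias of SURE is at most `2LM` times the risk, a relative
error that holds also at a random threshold.

Fluctuations. `Σ min(x_i², l²)` and `Σ y_i clip l x_i` are integrals over levels `t ≤ l` of sums of
independent terms, so the supremum over `l` is bounded by an integral of absolute centred sums and
only variances are needed (`exists_bound_integrated_process`). The counting term has jumps. It is
bracketed on about `d` levels and controlled by Hoeffding exponential moments, at the price of a
factor `log d` (`exists_bound_counting_process`). The term `Σ y_i²` does not involve `l`, and its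
centred version has mean zero. Minimality of SURE combines these bounds in `soft_oracle_inequality`.

Dependence on `C` alone. The variance must be bounded through `C`. A Stein kernel with `T_ii ≥ σ² -
L` forces the even moments to grow at least like those of a Gaussian of variance `σ² - L`, up to a
linear factor; the sub-Gaussian tail then gives `σ² ≤ C + L`
(`IsSteinKernel.le_of_integrable_exp_sq`). Since `M ≥ 1` and `LM < 1/2`, one has `L ≤ 1/2`. -/

/-! ### Weak derivatives of functions of one coordinate, and the coordinatewise Stein identity -/

section WeakDerivatives

variable {d : ℕ}

theorem volume_coord_mem_eq_zero (i : Fin d) {N : Set ℝ} (hN : N.Countable) :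
    (volume : Measure (EuclideanSpace ℝ (Fin d))) {x | x i ∈ N} = 0 := by
  have h : {x : EuclideanSpace ℝ (Fin d) | x i ∈ N} =
      ⋃ c ∈ N, {x : EuclideanSpace ℝ (Fin d) | x i = c} := by
    ext x; simp
  rw [h, measure_biUnion_null_iff hN]
  intro c _
  have h1 := (EuclideanSpace.volume_preserving_symm_measurableEquiv_toLp (Fin d)).measure_preimage
    (s := {f : Fin d → ℝ | f i = c})
    (measurableSet_eq_fun (measurable_pi_apply i) measurable_const).nullMeasurableSet
  rw [volume_pi, Measure.pi_hyperplane] at h1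
  exact h1

theorem hasFDerivAt_comp_coord {g : ℝ → ℝ} {a : ℝ} {i : Fin d} {x : EuclideanSpace ℝ (Fin d)}
    (h : HasDerivAt g a (x i)) :
    HasFDerivAt (fun y : EuclideanSpace ℝ (Fin d) => g (y i))
      (a • (EuclideanSpace.proj i : EuclideanSpace ℝ (Fin d) →L[ℝ] ℝ)) x :=
  HasDerivAt.comp_hasFDerivAt (h₂ := g)
    (f := fun y : EuclideanSpace ℝ (Fin d) => y i) x h
    (EuclideanSpace.proj i : EuclideanSpace ℝ (Fin d) →L[ℝ] ℝ).hasFDerivAt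

theorem measurable_coord (i : Fin d) : Measurable fun x : EuclideanSpace ℝ (Fin d) => x i :=
  (EuclideanSpace.proj i : EuclideanSpace ℝ (Fin d) →L[ℝ] ℝ).continuous.measurable

theorem continuous_coord (i : Fin d) : Continuous fun x : EuclideanSpace ℝ (Fin d) => x i :=
  (EuclideanSpace.proj i : EuclideanSpace ℝ (Fin d) →L[ℝ] ℝ).continuous

/-- Weak partial derivatives of a Lipschitz function of one coordinate. -/
theorem isWeakPartial_coord_of_lipschitz {g g' : ℝ → ℝ} {K : NNReal} (hg : LipschitzWith K g)
    {N : Set ℝ} (hN : N.Countable) (hd : ∀ s ∉ N, HasDerivAt g (g' s) s)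
    (hm : Measurable g') {b : ℝ} (hb : ∀ s, |g' s| ≤ b) (i j : Fin d) :
    IsWeakPartial j (fun x : EuclideanSpace ℝ (Fin d) => g (x i))
      (fun x => if i = j then g' (x i) else 0) := by
  refine ⟨(hg.continuous.comp (continuous_coord i)).locallyIntegrable, ?_, ?_⟩
  · have : Measurable fun x : EuclideanSpace ℝ (Fin d) => if i = j then g' (x i) else 0 := by
      split_ifs
      · exact hm.comp (measurable_coord i)
      · exact measurable_const
    refine (locallyIntegrable_const |b|).mono this.aestronglyMeasurable (ae_of_all _ fun x => ?_)
    split_ifs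
    · simpa using (hb _).trans (le_abs_self b)
    · simp
  · intro ψ hψ hc
    have hl : LipschitzWith K fun x : EuclideanSpace ℝ (Fin d) => g (x i) := by
      have h1 : LipschitzWith 1 fun x : EuclideanSpace ℝ (Fin d) => x i :=
        LipschitzWith.of_dist_le_mul fun x y => by
          simpa [dist_eq_norm] using PiLp.norm_apply_le (x - y) i
      simpa [Function.comp_def] using hg.comp h1
    obtain ⟨D, hD⟩ := ContDiff.lipschitzWith_of_hasCompactSupport hc hψ (by simp)
    -- Integration by parts for a Lipschitz function against a compactly supported one; its almost
    -- everywhere derivative is then identified off the null set where the coordinate lies in `N`.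
    have key := hl.integral_lineDeriv_mul_eq (μ := volume) hD hc (EuclideanSpace.single j 1)
    have hψd : Differentiable ℝ ψ := hψ.differentiable (by simp)
    have e1 : ∀ x, lineDeriv ℝ ψ x (-EuclideanSpace.single j 1) * g (x i) =
        - (g (x i) * fderiv ℝ ψ x (EuclideanSpace.single j 1)) := fun x => by
      rw [(hψd x).lineDeriv_eq_fderiv, map_neg]; ring
    have e2 : (fun x => lineDeriv ℝ (fun x : EuclideanSpace ℝ (Fin d) => g (x i)) x
        (EuclideanSpace.single j 1) * ψ x) =ᵐ[volume]
        fun x => (if i = j then g' (x i) else 0) * ψ x := by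
      have : ∀ᵐ x : EuclideanSpace ℝ (Fin d), x i ∉ N := by
        rw [ae_iff]; simpa using volume_coord_mem_eq_zero i hN
      filter_upwards [this] with x hx
      rw [((hasFDerivAt_comp_coord (hd _ hx)).hasLineDerivAt _).lineDeriv]
      by_cases hij : i = j <;> simp [hij]
    simp_rw [e1] at key
    rw [integral_congr_ae e2, integral_neg] at key
    linarith

/-- Weak partial derivatives of a continuously differentiable function of one coordinate. -/
theorem isWeakPartial_coord_of_hasDerivAt {g g' : ℝ → ℝ} (hd : ∀ s, HasDerivAt g (g' s) s)
    (hc' : Continuous g') (i j : Fin d) :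
    IsWeakPartial j (fun x : EuclideanSpace ℝ (Fin d) => g (x i))
      (fun x => if i = j then g' (x i) else 0) := by
  have hc : Continuous g := continuous_iff_continuousAt.2 fun s => (hd s).continuousAt
  have hv : Continuous fun x : EuclideanSpace ℝ (Fin d) => if i = j then g' (x i) else 0 := by
    split_ifs
    · exact hc'.comp (continuous_coord i)
    · exact continuous_const
  have hu := hc.comp (continuous_coord (d := d) i)
  refine ⟨hu.locallyIntegrable, hv.locallyIntegrable, fun ψ hψ hs => ?_⟩
  have hψd : Differentiable ℝ ψ := hψ.differentiable (by simp)
  have hf : ∀ x : EuclideanSpace ℝ (Fin d), fderiv ℝ (fun y => g (y i)) x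
      (EuclideanSpace.single j 1) = if i = j then g' (x i) else 0 := fun x => by
    rw [(hasFDerivAt_comp_coord (hd _)).fderiv]
    by_cases hij : i = j <;> simp [hij]
  have h3 : Continuous fun x => fderiv ℝ ψ x (EuclideanSpace.single j 1) :=
    (hψ.continuous_fderiv (by simp)).clm_apply continuous_const
  have h4 : HasCompactSupport fun x => fderiv ℝ ψ x (EuclideanSpace.single j 1) :=
    hs.fderiv_apply (𝕜 := ℝ) _
  rw [integral_mul_fderiv_eq_neg_fderiv_mul_of_integrable]
  · simp_rw [hf]
  · simp_rw [hf]
    exact (hv.mul hψ.continuous).integrable_of_hasCompactSupport hs.mul_left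
  · exact (hu.mul h3).integrable_of_hasCompactSupport h4.mul_left
  · exact (hu.mul hψ.continuous).integrable_of_hasCompactSupport hs.mul_left
  · exact fun x _ => (hasFDerivAt_comp_coord (hd _)).differentiableAt
  · exact fun x _ => hψd x

/-- The Stein identity for vector fields `y ↦ g (y i) e_i`. -/
theorem IsSteinKernel.coord {ν : Measure (EuclideanSpace ℝ (Fin d))}
    {T : EuclideanSpace ℝ (Fin d) → Matrix (Fin d) (Fin d) ℝ} (hT : IsSteinKernel ν T)
    (i : Fin d) {g g' : ℝ → ℝ} (hg : MemLp (fun y : EuclideanSpace ℝ (Fin d) => g (y i)) 2 ν)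
    (hg' : MemLp (fun y : EuclideanSpace ℝ (Fin d) => g' (y i)) 2 ν)
    (hw : ∀ j, IsWeakPartial j (fun x : EuclideanSpace ℝ (Fin d) => g (x i))
      (fun x => if i = j then g' (x i) else 0)) :
    ∫ y, y i * g (y i) ∂ν = ∫ y, T y i i * g' (y i) ∂ν := by
  have h := hT.2 (fun y => EuclideanSpace.single i (g (y i)))
    (fun y => Matrix.diagonal (Pi.single i (g' (y i)))) ⟨?_, ?_, ?_⟩
  · have e1 : ∀ y : EuclideanSpace ℝ (Fin d),
        inner ℝ y (EuclideanSpace.single i (g (y i))) = y i * g (y i) := fun y => by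
      rw [EuclideanSpace.inner_single_right]; simp [mul_comm]
    have e2 : ∀ y : EuclideanSpace ℝ (Fin d),
        ∑ k, ∑ j, T y k j * (Matrix.diagonal (Pi.single i (g' (y i))) : Matrix _ _ ℝ) k j =
          T y i i * g' (y i) := fun y => by
      simp [Matrix.diagonal_apply, Pi.single_apply]
    simpa only [e1, e2] using h
  · have h1 := (ContinuousLinearMap.toSpanSingleton ℝ
      (EuclideanSpace.single i (1 : ℝ) : EuclideanSpace ℝ (Fin d))).comp_memLp' hg
    have h2 : (fun y : EuclideanSpace ℝ (Fin d) => EuclideanSpace.single i (g (y i))) =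
        (ContinuousLinearMap.toSpanSingleton ℝ
          (EuclideanSpace.single i (1 : ℝ) : EuclideanSpace ℝ (Fin d))) ∘ fun y => g (y i) := by
      funext y
      ext k
      simp
    rw [h2]
    exact h1
  · intro k j
    by_cases hkj : k = j
    · by_cases hk : k = i
      · subst hkj hk; simpa using hg'
      · subst hkj; simp [hk]
    · simp [hkj]
  · intro k j
    by_cases hk : k = i
    · subst hk
      convert hw j using 2 with x x
      · simp
      · simp [Matrix.diagonal_apply]
    · have h0 : IsWeakPartial j (fun _ : EuclideanSpace ℝ (Fin d) => (0 : ℝ)) (fun _ => 0) :=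
        ⟨locallyIntegrable_const 0, locallyIntegrable_const 0, by simp⟩
      convert h0 using 2 with x x
      · simp [hk]
      · simp [Matrix.diagonal_apply, hk]

end WeakDerivatives

/-! ### Moment growth and the bound on the variance -/

section Moments

/-- Layer cake: at half the exponential rate the tail of `exp (Z² / (2C))` at `t > 1` is at most `a
t⁻²`, which is integrable at infinity. -/
theorem integrable_exp_sq_of_tail {Ω : Type*} [MeasurableSpace Ω] {P : Measure Ω}
    [IsProbabilityMeasure P] {Z : Ω → ℝ} (hZ : Measurable Z) (hZ0 : ∀ ω, 0 ≤ Z ω)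
    {C a : ℝ} (hC : 0 < C)
    (h : ∀ t : ℝ, 0 < t → P.real {ω | t ≤ Z ω} ≤ a * Real.exp (-t ^ 2 / C)) :
    Integrable (fun ω => Real.exp (Z ω ^ 2 / (2 * C))) P := by
  have hm : Measurable fun ω => Real.exp (Z ω ^ 2 / (2 * C)) := by fun_prop
  refine ⟨hm.aestronglyMeasurable, ?_⟩
  rw [hasFiniteIntegral_iff_ofReal (ae_of_all _ fun ω => (Real.exp_pos _).le),
    lintegral_eq_lintegral_meas_le P (ae_of_all _ fun ω => (Real.exp_pos _).le) hm.aemeasurable]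
  have hsplit : Set.Ioi (0 : ℝ) = Set.Ioc 0 1 ∪ Set.Ioi 1 := by
    rw [Set.Ioc_union_Ioi_eq_Ioi zero_le_one]
  rw [hsplit]
  refine (lintegral_union_le _ _ _).trans_lt (ENNReal.add_lt_top.2 ⟨?_, ?_⟩)
  · calc _ ≤ ∫⁻ t in Set.Ioc (0 : ℝ) 1, 1 := lintegral_mono fun t => prob_le_one
      _ < ⊤ := by simp
  · have hint : IntegrableOn (fun t : ℝ => a * t ^ (-2 : ℝ)) (Set.Ioi 1) :=
      (integrableOn_Ioi_rpow_of_lt (by norm_num) one_pos).const_mul a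
    refine lt_of_le_of_lt (setLIntegral_mono' measurableSet_Ioi fun t ht => ?_)
      hint.lintegral_lt_top
    have ht1 : (1 : ℝ) < t := ht
    have hl : 0 < Real.log t := Real.log_pos ht1
    have hpos : 0 < 2 * C * Real.log t := by positivity
    have hsub : {ω | t ≤ Real.exp (Z ω ^ 2 / (2 * C))} ⊆
        {ω | Real.sqrt (2 * C * Real.log t) ≤ Z ω} := by
      intro ω hω
      have h1 : Real.log t ≤ Z ω ^ 2 / (2 * C) :=
        (Real.log_le_iff_le_exp (by linarith)).2 hω
      rw [le_div_iff₀ (by positivity)] at h1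
      exact Real.sqrt_le_iff.2 ⟨hZ0 ω, by linarith⟩
    refine (measure_mono hsub).trans ?_
    rw [← ofReal_measureReal]
    refine ENNReal.ofReal_le_ofReal ((h _ (Real.sqrt_pos.2 hpos)).trans (le_of_eq ?_))
    rw [Real.sq_sqrt hpos.le, Real.rpow_def_of_pos (by linarith)]
    congr 2
    field_simp

/-- This is `u ^ k / k! ≤ exp u` at `u = Z² / (2C)`. The growth `k! (2C)^k` has the geometric rate
that is later compared with the lower bound from the Stein kernel. -/
theorem integrable_pow_of_integrable_exp_sq {Ω : Type*} [MeasurableSpace Ω] {P : Measure Ω}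
    [IsFiniteMeasure P] {Z : Ω → ℝ} (hZ : AEStronglyMeasurable Z P) {C : ℝ} (hC : 0 < C)
    (h : Integrable (fun ω => Real.exp (Z ω ^ 2 / (2 * C))) P) (k : ℕ) :
    Integrable (fun ω => Z ω ^ (2 * k)) P ∧
      ∫ ω, Z ω ^ (2 * k) ∂P ≤
        (k.factorial * (2 * C) ^ k) * ∫ ω, Real.exp (Z ω ^ 2 / (2 * C)) ∂P := by
  have hle : ∀ ω, Z ω ^ (2 * k) ≤
      (k.factorial * (2 * C) ^ k) * Real.exp (Z ω ^ 2 / (2 * C)) := fun ω => by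
    have h1 := Real.pow_div_factorial_le_exp (Z ω ^ 2 / (2 * C)) (by positivity) k
    rw [div_pow, div_div, div_le_iff₀ (by positivity)] at h1
    rw [pow_mul]; linarith
  have hi : Integrable (fun ω => Z ω ^ (2 * k)) P := by
    refine (h.const_mul (k.factorial * (2 * C) ^ k)).mono' (hZ.pow _) (ae_of_all _ fun ω => ?_)
    rw [Real.norm_of_nonneg (by rw [pow_mul]; positivity)]
    exact hle ω
  refine ⟨hi, ?_⟩
  rw [← integral_const_mul]
  exact integral_mono hi (h.const_mul _) hle

theorem memLp_two_pow_of_integrable_exp_sq {Ω : Type*} [MeasurableSpace Ω] {P : Measure Ω}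
    [IsFiniteMeasure P] {Z : Ω → ℝ} (hZ : AEStronglyMeasurable Z P) {C : ℝ} (hC : 0 < C)
    (h : Integrable (fun ω => Real.exp (Z ω ^ 2 / (2 * C))) P) (k : ℕ) :
    MemLp (fun ω => Z ω ^ k) 2 P := by
  refine (memLp_two_iff_integrable_sq (f := fun ω => Z ω ^ k) (hZ.pow k)).2 ?_
  simpa only [← pow_mul, mul_comm] using (integrable_pow_of_integrable_exp_sq hZ hC h k).1

theorem le_of_pow_le_linear {r K : ℝ} (h : ∀ k : ℕ, r ^ k ≤ (k + 1) * K) : r ≤ 1 := by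
  by_contra! hr
  have h1 := (tendsto_pow_const_div_const_pow_of_one_lt 1 hr)
  have h2 := (tendsto_pow_const_div_const_pow_of_one_lt 0 hr)
  have h3 : Filter.Tendsto (fun k : ℕ => ((k : ℝ) ^ 1 / r ^ k + (k : ℝ) ^ 0 / r ^ k) * K)
      Filter.atTop (nhds 0) := by simpa using (h1.add h2).mul_const K
  have h4 : (1 : ℝ) ≤ 0 := ge_of_tendsto' h3 fun k => by
    have : 0 < r ^ k := by positivity
    rw [← add_div, div_mul_eq_mul_div, le_div_iff₀ this]
    simpa using h k
  linarith

/-- A Stein kernel uniformly close to the constant `s` forces Gaussian-type moment growth, hence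
`s` is controlled by the sub-Gaussian scaling constant. -/
theorem IsSteinKernel.le_of_integrable_exp_sq {d : ℕ} {ν : Measure (EuclideanSpace ℝ (Fin d))}
    [IsProbabilityMeasure ν] {T : EuclideanSpace ℝ (Fin d) → Matrix (Fin d) (Fin d) ℝ}
    (hT : IsSteinKernel ν T) (i : Fin d) {C s δ : ℝ} (hC : 0 < C)
    (hexp : Integrable (fun y : EuclideanSpace ℝ (Fin d) => Real.exp (y i ^ 2 / (2 * C))) ν)
    (hs : ∀ᵐ y ∂ν, |s - T y i i| ≤ δ) : s ≤ C + δ := by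
  by_contra! hlt
  have hc : 0 < s - δ := by linarith
  have hmeas : AEStronglyMeasurable (fun y : EuclideanSpace ℝ (Fin d) => y i) ν :=
    (measurable_coord i).aestronglyMeasurable
  have hL := memLp_two_pow_of_integrable_exp_sq hmeas hC hexp
  have hI := fun k => integrable_pow_of_integrable_exp_sq hmeas hC hexp k
  -- The Stein identity with `g(x) = x^(2k+1)` gives the Gaussian moment recursion, with `T_ii ≥ s -
  -- δ` in the role of the variance.
  have hrec : ∀ k : ℕ, (2 * k + 1) * (s - δ) * ∫ y, y i ^ (2 * k) ∂ν ≤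
      ∫ y, y i ^ (2 * (k + 1)) ∂ν := by
    intro k
    have hst := hT.coord i (g := fun x => x ^ (2 * k + 1))
      (g' := fun x => (2 * (k : ℝ) + 1) * x ^ (2 * k)) (hL _) ((hL _).const_mul _)
      (isWeakPartial_coord_of_hasDerivAt (fun x => by
        simpa using hasDerivAt_pow (2 * k + 1) x) (by fun_prop) i)
    have e1 : ∫ y, y i ^ (2 * (k + 1)) ∂ν = ∫ y, y i * y i ^ (2 * k + 1) ∂ν := by
      congr 1; ext y; ring
    rw [e1, hst, ← integral_const_mul]
    refine integral_mono_ae ((hI k).1.const_mul _)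
      ((hT.1 i i).integrable_mul ((hL (2 * k)).const_mul _)) ?_
    filter_upwards [hs] with y hy
    have h1 : s - δ ≤ T y i i := by linarith [(abs_le.1 hy).2]
    have h2 : 0 ≤ (2 * (k : ℝ) + 1) * y i ^ (2 * k) := by rw [pow_mul]; positivity
    nlinarith [mul_le_mul_of_nonneg_right h1 h2]
  -- Iterating the recursion gives `(2k-1)!! (s - δ)^k`; here `(2k-1)!!` is replaced by the smaller
  -- `2^k k! / (k+1)`, which matches the upper bound up to a linear factor.
  have hlow : ∀ k : ℕ, (s - δ) ^ k * 2 ^ k * k.factorial ≤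
      (k + 1) * ∫ y, y i ^ (2 * k) ∂ν := by
    intro k
    induction k with
    | zero => simp
    | succ k ih =>
      have h1 := hrec k
      have hm : 0 ≤ ∫ y, y i ^ (2 * k) ∂ν :=
        integral_nonneg fun y => by simp only [pow_mul]; positivity
      rw [Nat.factorial_succ]
      push_cast
      have hk : (0 : ℝ) ≤ k := k.cast_nonneg
      calc (s - δ) ^ (k + 1) * 2 ^ (k + 1) * ((k + 1) * k.factorial)
          = (s - δ) * 2 * (k + 1) * ((s - δ) ^ k * 2 ^ k * k.factorial) := by ring
        _ ≤ (s - δ) * 2 * (k + 1) * ((k + 1) * ∫ y, y i ^ (2 * k) ∂ν) := by gcongr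
        -- Uses `2 (k+1)² ≤ (k+2)(2k+1)`, whose sides differ by `k`.
        _ ≤ (k + 1 + 1) * ((2 * k + 1) * (s - δ) * ∫ y, y i ^ (2 * k) ∂ν) := by
          have : 0 ≤ (s - δ) * (∫ y, y i ^ (2 * k) ∂ν) * k := by positivity
          nlinarith
        _ ≤ _ := by gcongr
  have hfin : (s - δ) / C ≤ 1 := by
    refine le_of_pow_le_linear
      (K := ∫ y : EuclideanSpace ℝ (Fin d), Real.exp (y i ^ 2 / (2 * C)) ∂ν) fun k => ?_
    have h1 := (hlow k).trans (mul_le_mul_of_nonneg_left (hI k).2 (by positivity))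
    rw [div_pow, div_le_iff₀ (by positivity)]
    have h2 : (0 : ℝ) < 2 ^ k * k.factorial := by positivity
    refine le_of_mul_le_mul_right ?_ h2
    rw [mul_pow] at h1
    linarith
  rw [div_le_one hC] at hfin
  linarith

end Moments

/-! ### Truncation and its layer-cake representations -/

section Clip

/-- Truncation of `x` to the interval `[-l, l]`. -/
noncomputable def clip (l x : ℝ) : ℝ := max (-l) (min x l)

theorem clip_of_abs_le {l x : ℝ} (h : |x| ≤ l) : clip l x = x := by
  rw [clip, min_eq_left (abs_le.1 h).2, max_eq_right (abs_le.1 h).1]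

theorem clip_of_lt_abs {l x : ℝ} (hl : 0 ≤ l) (h : l < |x|) : clip l x = Real.sign x * l := by
  rcases lt_abs.1 h with h | h
  · rw [Real.sign_of_pos (by linarith), clip, min_eq_right h.le, max_eq_right (by linarith),
      one_mul]
  · rw [Real.sign_of_neg (by linarith), clip, min_eq_left (by linarith), max_eq_left (by linarith),
      neg_one_mul]

theorem sign_mul_abs_self (x : ℝ) : Real.sign x * |x| = x := by
  rcases lt_trichotomy x 0 with h | h | h
  · rw [Real.sign_of_neg h, abs_of_neg h]; ring
  · simp [h]
  · rw [Real.sign_of_pos h, abs_of_pos h]; ring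

theorem abs_sign_le_one (x : ℝ) : |Real.sign x| ≤ 1 := by
  rcases Real.sign_apply_eq x with h | h | h <;> simp [h]

theorem measurable_sign : Measurable Real.sign :=
  Measurable.ite measurableSet_Iio measurable_const
    (Measurable.ite measurableSet_Ioi measurable_const measurable_const)

theorem clip_eq_sign_mul {l : ℝ} (hl : 0 ≤ l) (x : ℝ) : clip l x = Real.sign x * min |x| l := by
  rcases le_or_gt |x| l with h | h
  · rw [clip_of_abs_le h, min_eq_left h, sign_mul_abs_self]
  · rw [clip_of_lt_abs hl h, min_eq_right h.le]

theorem softThreshold_apply {d : ℕ} {l : ℝ} (hl : 0 ≤ l) (x : EuclideanSpace ℝ (Fin d))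
    (i : Fin d) : softThreshold l x i = x i - clip l (x i) := by
  have : softThreshold l x i = Real.sign (x i) * max (|x i| - l) 0 := rfl
  rw [this, clip_eq_sign_mul hl]
  rcases le_or_gt |x i| l with h | h
  · rw [max_eq_right (by linarith), min_eq_left h, sign_mul_abs_self]; ring
  · rw [max_eq_left (by linarith), min_eq_right h.le, mul_sub, sign_mul_abs_self]

theorem abs_clip_le {l : ℝ} (hl : 0 ≤ l) (x : ℝ) : |clip l x| ≤ l := by
  rw [clip, abs_le]
  exact ⟨le_max_left _ _, max_le (by linarith) (min_le_right _ _)⟩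

theorem clip_sq {l : ℝ} (hl : 0 ≤ l) (x : ℝ) : clip l x ^ 2 = min (x ^ 2) (l ^ 2) := by
  rcases le_or_gt |x| l with h | h
  · rw [clip_of_abs_le h, min_eq_left (sq_le_sq.2 (by rwa [abs_of_nonneg hl]))]
  · rw [min_eq_right (sq_le_sq.2 (by rw [abs_of_nonneg hl]; exact h.le)), clip_of_lt_abs hl h,
      mul_pow]
    have : Real.sign x ^ 2 = 1 := by
      have hx : x ≠ 0 := by rintro rfl; simp at h; linarith
      rcases Real.sign_apply_eq_of_ne_zero x hx with h | h <;> simp [h]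
    rw [this, one_mul]

theorem continuous_clip_uncurry : Continuous fun p : ℝ × ℝ => clip p.1 p.2 := by
  unfold clip; fun_prop

theorem lipschitzWith_clip (l : ℝ) : LipschitzWith 1 (clip l) :=
  (LipschitzWith.id.min_const l).const_max (-l)

theorem hasDerivAt_clip {l x : ℝ} (hl : 0 ≤ l) (hx : |x| ≠ l) :
    HasDerivAt (clip l) (if |x| ≤ l then 1 else 0) x := by
  rcases lt_or_gt_of_ne hx with h | h
  · rw [if_pos h.le]
    refine (hasDerivAt_id x).congr_of_eventuallyEq ?_
    filter_upwards [(isOpen_lt continuous_abs continuous_const).mem_nhds h] with y hy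
    exact clip_of_abs_le (le_of_lt hy)
  · rw [if_neg (not_le.2 h)]
    rcases lt_abs.1 h with h | h
    · refine (hasDerivAt_const x l).congr_of_eventuallyEq ?_
      filter_upwards [isOpen_Ioi.mem_nhds h] with y hy
      have hy : l < y := hy
      rw [clip, min_eq_right hy.le, max_eq_right (by linarith)]
    · refine (hasDerivAt_const x (-l)).congr_of_eventuallyEq ?_
      filter_upwards [isOpen_Iio.mem_nhds (show x < -l by linarith)] with y hy
      have hy : y < -l := hy
      rw [clip, min_eq_left (by linarith), max_eq_left (by linarith)]

/-- With `b = |x|`, this writes functions of `min |x| l` as integrals over levels, so that `l`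
enters only as the upper limit of integration. -/
theorem setIntegral_Ioc_mul_indicator_lt {k : ℝ → ℝ} {l b : ℝ} :
    ∫ t in Set.Ioc 0 l, k t * (if t < b then 1 else 0) = ∫ t in Set.Ioc 0 (min b l), k t := by
  have h1 : ∀ t : ℝ, k t * (if t < b then 1 else 0) = (Set.Iio b).indicator k t := fun t => by
    by_cases h : t < b <;> simp [Set.indicator, h]
  simp_rw [h1]
  rw [setIntegral_indicator measurableSet_Iio]
  refine setIntegral_congr_set ?_
  have h2 : (Set.Ioc 0 l ∩ Set.Iic b : Set ℝ) = Set.Ioc 0 (min b l) := by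
    ext t; simp only [Set.mem_inter_iff, Set.mem_Ioc, Set.mem_Iic, le_min_iff]; tauto
  rw [← h2]
  -- The strict and the weak indicator differ only at the single point `t = b`.
  exact (ae_eq_refl _).inter Iio_ae_eq_Iic

theorem setIntegral_Ioc_id {c : ℝ} (hc : 0 ≤ c) : ∫ t in Set.Ioc 0 c, 2 * t = c ^ 2 := by
  rw [← intervalIntegral.integral_of_le hc, intervalIntegral.integral_const_mul, integral_id]
  ring

theorem clip_eq_setIntegral {l : ℝ} (hl : 0 ≤ l) (x : ℝ) :
    clip l x = Real.sign x * ∫ t in Set.Ioc 0 l, 1 * (if t < |x| then 1 else 0) := by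
  rw [setIntegral_Ioc_mul_indicator_lt (k := fun _ => 1), clip_eq_sign_mul hl]
  simp [le_min (abs_nonneg x) hl]

theorem min_sq_eq_setIntegral {l : ℝ} (hl : 0 ≤ l) (x : ℝ) :
    min (x ^ 2) (l ^ 2) = ∫ t in Set.Ioc 0 l, 2 * t * (if t < |x| then 1 else 0) := by
  rw [setIntegral_Ioc_mul_indicator_lt (k := fun t => 2 * t),
    setIntegral_Ioc_id (le_min (abs_nonneg x) hl), ← clip_sq hl, clip_eq_sign_mul hl]
  rw [← sq_abs, abs_mul, mul_pow, abs_of_nonneg (le_min (abs_nonneg x) hl)]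
  by_cases hx : x = 0
  · simp [hx, hl]
  · rcases Real.sign_apply_eq_of_ne_zero x hx with h | h <;> simp [h]

end Clip

/-! ### Uniform fluctuations of integrated indicator processes -/

section IntegratedProcess

variable {Ω : Type*} [MeasurableSpace Ω] {P : Measure Ω} [IsProbabilityMeasure P]

/-- The variance of the sum is the sum of the variances, each at most a second moment; the first
absolute moment is at most the root of the second. -/
theorem integral_abs_centered_sum_le {n : ℕ} {Z : Fin n → Ω → ℝ} (hZ : ∀ i, MemLp (Z i) 2 P)
    (hind : Pairwise fun i j => Z i ⟂ᵢ[P] Z j) {v : ℝ} (hv : ∀ i, ∫ ω, Z i ω ^ 2 ∂P ≤ v) :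
    ∫ ω, |∑ i, (Z i ω - ∫ ω', Z i ω' ∂P)| ∂P ≤ Real.sqrt (n * v) := by
  have hS : MemLp (∑ i, Z i) 2 P := memLp_finsetSum' _ fun i _ => hZ i
  have hmean : ∫ ω, (∑ i, Z i) ω ∂P = ∑ i, ∫ ω, Z i ω ∂P := by
    simp only [Finset.sum_apply]
    exact integral_finsetSum _ fun i _ => (hZ i).integrable (by norm_num)
  set S : Ω → ℝ := fun ω => ∑ i, (Z i ω - ∫ ω', Z i ω' ∂P) with hSdef
  have hSL : MemLp S 2 P := memLp_finsetSum _ fun i _ => (hZ i).sub (memLp_const _)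
  have hvar : ∫ ω, S ω ^ 2 ∂P ≤ n * v := by
    have h1 : ∫ ω, S ω ^ 2 ∂P = Var[∑ i, Z i; P] := by
      rw [variance_eq_integral hS.aestronglyMeasurable.aemeasurable, hmean]
      simp [hSdef, Finset.sum_sub_distrib]
    rw [h1, IndepFun.variance_sum (fun i _ => hZ i) fun i _ j _ hij => hind hij]
    calc ∑ i, Var[Z i; P] ≤ ∑ _i : Fin n, v := Finset.sum_le_sum fun i _ =>
          (variance_le_expectation_sq (hZ i).aestronglyMeasurable).trans (hv i)
      _ = n * v := by simp
  -- Nonnegativity of the variance of `|S|`.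
  have hcs : (∫ ω, |S ω| ∂P) ^ 2 ≤ ∫ ω, S ω ^ 2 ∂P := by
    have h2 := variance_nonneg (fun ω => |S ω|) P
    have h3 := variance_eq_sub (X := fun ω => |S ω|) (μ := P) hSL.abs
    simp only [Pi.pow_apply, sq_abs] at h3
    linarith
  exact Real.le_sqrt_of_sq_le (hcs.trans hvar)

/-- Uniform control of the fluctuations of `∑ i, W i * ∫_0^l k(t) 1{t < A i} dt`, `l ≤ Λ`. -/
theorem exists_bound_integrated_process {n : ℕ} {W A : Fin n → Ω → ℝ}
    (hWm : ∀ i, Measurable (W i)) (hAm : ∀ i, Measurable (A i)) (hW : ∀ i, MemLp (W i) 2 P)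
    (hind : iIndepFun (fun i ω => (W i ω, A i ω)) P) {v : ℝ}
    (hv : ∀ i, ∫ ω, W i ω ^ 2 ∂P ≤ v) {k : ℝ → ℝ} (hk : Continuous k) (Λ : ℝ) :
    ∃ D : Ω → ℝ, Integrable D P ∧
      ∫ ω, D ω ∂P ≤ Real.sqrt (n * v) * ∫ t in Set.Ioc 0 Λ, |k t| ∧
      ∀ l ∈ Set.Icc 0 Λ, ∀ ω,
        |∑ i, (W i ω * ∫ t in Set.Ioc 0 l, k t * (if t < A i ω then 1 else 0)) -
          ∫ ω', ∑ i, (W i ω' * ∫ t in Set.Ioc 0 l, k t * (if t < A i ω' then 1 else 0)) ∂P|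
        ≤ D ω := by
  have hindm : ∀ i, Measurable fun p : ℝ × Ω => if p.1 < A i p.2 then (1 : ℝ) else 0 := fun i =>
    Measurable.ite (measurableSet_lt measurable_fst ((hAm i).comp measurable_snd))
      measurable_const measurable_const
  set Z : ℝ → Fin n → Ω → ℝ := fun t i ω => W i ω * (if t < A i ω then 1 else 0) with hZdef
  have hZm : ∀ i, Measurable fun p : ℝ × Ω => Z p.1 i p.2 := fun i =>
    ((hWm i).comp measurable_snd).mul (hindm i)
  have hZle : ∀ t i ω, |Z t i ω| ≤ |W i ω| := fun t i ω => by
    simp only [hZdef, abs_mul]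
    split_ifs <;> simp
  have hZL : ∀ t i, MemLp (Z t i) 2 P := fun t i =>
    (hW i).mono ((hZm i).comp measurable_prodMk_left).aestronglyMeasurable
      (ae_of_all _ fun ω => hZle t i ω)
  set g : ℝ → Ω → ℝ := fun t ω => ∑ i, (Z t i ω - ∫ ω', Z t i ω' ∂P) with hgdef
  have hkint : IntegrableOn (fun t => |k t|) (Set.Ioc 0 Λ) :=
    (hk.abs.integrableOn_Icc).mono_set Set.Ioc_subset_Icc_self
  have hkint' : IntegrableOn k (Set.Ioc 0 Λ) :=
    (hk.integrableOn_Icc).mono_set Set.Ioc_subset_Icc_self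
  -- integrability on the product space
  have hprod : ∀ i, Integrable (fun p : ℝ × Ω => k p.1 * Z p.1 i p.2)
      ((volume.restrict (Set.Ioc 0 Λ)).prod P) := fun i => by
    refine (hkint'.norm.mul_prod ((hW i).integrable (by norm_num)).norm).mono'
      ((hk.measurable.comp measurable_fst).mul (hZm i)).aestronglyMeasurable
      (ae_of_all _ fun p => ?_)
    rw [norm_mul]
    exact mul_le_mul_of_nonneg_left (hZle _ _ _) (norm_nonneg _)
  have hEint : ∀ i, IntegrableOn (fun t => k t * ∫ ω', Z t i ω' ∂P) (Set.Ioc 0 Λ) := fun i => by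
    have := (hprod i).integral_prod_left
    simpa only [integral_const_mul, IntegrableOn] using this
  have hωint : ∀ i ω, IntegrableOn (fun t => k t * Z t i ω) (Set.Ioc 0 Λ) := fun i ω => by
    refine (hkint.mul_const |W i ω|).mono'
      (hk.measurable.mul ((hZm i).comp measurable_prodMk_right)).aestronglyMeasurable
      (ae_of_all _ fun t => ?_)
    rw [norm_mul]
    exact mul_le_mul_of_nonneg_left (hZle _ _ _) (norm_nonneg _)
  have hgprod : Integrable (fun p : ℝ × Ω => |k p.1 * g p.1 p.2|)
      ((volume.restrict (Set.Ioc 0 Λ)).prod P) := by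
    refine Integrable.abs ?_
    have : (fun p : ℝ × Ω => k p.1 * g p.1 p.2) = fun p =>
        ∑ i, (k p.1 * Z p.1 i p.2 - k p.1 * ∫ ω', Z p.1 i ω' ∂P) := by
      funext p; simp [hgdef, Finset.mul_sum, mul_sub]
    rw [this]
    exact integrable_finsetSum _ fun i _ => (hprod i).sub ((hEint i).comp_fst P)
  -- After centring under the integral, the process at `l` is the integral of `k t * g t` over `(0,
  -- l]`. Absolute values and the larger domain `(0, Λ]` remove `l`, and Fubini reduces the mean to
  -- a bound on `E |g t|` at each fixed level.
  refine ⟨fun ω => ∫ t in Set.Ioc 0 Λ, |k t * g t ω|, hgprod.integral_prod_right, ?_, ?_⟩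
  · rw [← integral_integral_swap (f := fun t ω => |k t * g t ω|) hgprod, ← integral_const_mul]
    refine integral_mono hgprod.integral_prod_left (hkint.const_mul _) fun t => ?_
    simp only [abs_mul, integral_const_mul]
    rw [mul_comm]
    refine mul_le_mul_of_nonneg_right ?_ (abs_nonneg _)
    refine integral_abs_centered_sum_le (hZL t) ?_ fun i => ?_
    · intro i j hij
      have hm : Measurable fun q : ℝ × ℝ => q.1 * (if t < q.2 then (1 : ℝ) else 0) :=
        measurable_fst.mul (Measurable.ite (measurableSet_lt measurable_const measurable_snd)
          measurable_const measurable_const)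
      exact (hind.indepFun hij).comp hm hm
    · refine (integral_mono (hZL t i).integrable_sq (hW i).integrable_sq fun ω => ?_).trans (hv i)
      exact sq_le_sq.2 (hZle t i ω)
  · intro l hl ω
    have hsub : Set.Ioc 0 l ⊆ Set.Ioc 0 Λ := Set.Ioc_subset_Ioc_right hl.2
    have e1 : ∀ i ω, W i ω * ∫ t in Set.Ioc 0 l, k t * (if t < A i ω then 1 else 0) =
        ∫ t in Set.Ioc 0 l, k t * Z t i ω := fun i ω => by
      rw [← integral_const_mul]
      congr 1; funext t; simp only [hZdef]; ring
    have hprodl : ∀ i, Integrable (fun p : ℝ × Ω => k p.1 * Z p.1 i p.2)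
        ((volume.restrict (Set.Ioc 0 l)).prod P) := fun i =>
      (hprod i).mono_measure (Measure.prod_mono (Measure.restrict_mono_set _ hsub) le_rfl)
    have e2 : ∫ ω', (∑ i, ∫ t in Set.Ioc 0 l, k t * Z t i ω') ∂P =
        ∑ i, ∫ t in Set.Ioc 0 l, k t * ∫ ω', Z t i ω' ∂P := by
      rw [integral_finsetSum _ fun i _ => (hprodl i).integral_prod_right]
      refine Finset.sum_congr rfl fun i _ => ?_
      rw [← integral_integral_swap (f := fun t ω => k t * Z t i ω) (hprodl i)]
      simp only [integral_const_mul]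
    have e3 : ∑ i, (∫ t in Set.Ioc 0 l, k t * Z t i ω) -
        ∑ i, ∫ t in Set.Ioc 0 l, k t * ∫ ω', Z t i ω' ∂P = ∫ t in Set.Ioc 0 l, k t * g t ω := by
      rw [← Finset.sum_sub_distrib]
      have h4 : ∀ t, k t * g t ω = ∑ i, (k t * Z t i ω - k t * ∫ ω', Z t i ω' ∂P) := fun t => by
        simp [hgdef, Finset.mul_sum, mul_sub]
      simp_rw [h4]
      rw [integral_finsetSum]
      · exact Finset.sum_congr rfl fun i _ =>
          (integral_sub ((hωint i ω).mono_set hsub) ((hEint i).mono_set hsub)).symm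
      · exact fun i _ => ((hωint i ω).mono_set hsub).sub ((hEint i).mono_set hsub)
    simp_rw [e1]
    rw [e2, e3]
    refine (abs_integral_le_integral_abs).trans ?_
    refine setIntegral_mono_set ?_ (ae_of_all _ fun t => abs_nonneg _) hsub.eventuallyLE
    have h5 : (fun t => |k t * g t ω|) = fun t =>
        |∑ i, (k t * Z t i ω - k t * ∫ ω', Z t i ω' ∂P)| := by
      funext t; simp [hgdef, Finset.mul_sum, mul_sub]
    rw [h5]
    exact (integrable_finsetSum _ fun i _ => (hωint i ω).sub (hEint i)).abs

end IntegratedProcess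

/-! ### Uniform fluctuations of the counting process -/

section CountingProcess

/-- Each step of the induction uses the intermediate value theorem to split off a point where `F`
has risen by exactly 1. Membership of the left endpoint in the set makes that point available as the
right end of the new bracket. -/
theorem exists_finset_bracketing {F : ℝ → ℝ} (hF : Continuous F) (n : ℕ) :
    ∀ a b : ℝ, a ≤ b → F b - F a ≤ n → ∃ s : Finset ℝ, a ∈ s ∧ s.card ≤ n + 2 ∧
      ∀ l ∈ Set.Icc a b, ∃ p ∈ s, ∃ q ∈ s, p ≤ l ∧ l ≤ q ∧ F q - F p ≤ 1 := by
  have hpair : ∀ (m : ℕ) (a b : ℝ), F b - F a ≤ 1 → ∃ s : Finset ℝ, a ∈ s ∧ s.card ≤ m + 2 ∧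
      ∀ l ∈ Set.Icc a b, ∃ p ∈ s, ∃ q ∈ s, p ≤ l ∧ l ≤ q ∧ F q - F p ≤ 1 := fun m a b h =>
    ⟨{a, b}, by simp, Finset.card_le_two.trans (by omega), fun l hl =>
      ⟨a, by simp, b, by simp, hl.1, hl.2, h⟩⟩
  induction n with
  | zero => exact fun a b _ h => hpair 0 a b (by simp at h; linarith)
  | succ n ih =>
    intro a b hab h
    by_cases h1 : F b - F a ≤ 1
    · exact hpair (n + 1) a b h1
    · obtain ⟨c, hc, hFc⟩ := intermediate_value_Icc hab hF.continuousOn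
        (show F a + 1 ∈ Set.Icc (F a) (F b) from ⟨by linarith, by linarith⟩)
      push_cast at h
      obtain ⟨s, hcs, hcard, hs⟩ := ih c b hc.2 (by linarith)
      refine ⟨insert a s, Finset.mem_insert_self _ _,
        (Finset.card_insert_le _ _).trans (by omega), fun l hl => ?_⟩
      rcases le_total l c with h2 | h2
      · exact ⟨a, by simp, c, by simp [hcs], hl.1, h2, by linarith⟩
      · obtain ⟨p, hp, q, hq, hpq⟩ := hs l ⟨h2, hl.2⟩
        exact ⟨p, by simp [hp], q, by simp [hq], hpq⟩

variable {Ω : Type*} [MeasurableSpace Ω] {P : Measure Ω} [IsProbabilityMeasure P]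

theorem measurable_ite_le {A : Ω → ℝ} (hA : Measurable A) (l : ℝ) :
    Measurable fun ω => if A ω ≤ l then (1 : ℝ) else 0 :=
  Measurable.ite (measurableSet_le hA measurable_const) measurable_const measurable_const

theorem integrable_ite_le {A : Ω → ℝ} (hA : Measurable A) (l : ℝ) :
    Integrable (fun ω => if A ω ≤ l then (1 : ℝ) else 0) P :=
  (integrable_const (1 : ℝ)).mono' (measurable_ite_le hA l).aestronglyMeasurable
    (ae_of_all _ fun ω => by split_ifs <;> simp)

/-- The indicator is continuous in `l` at `c` except on `{A = c}`, which is null; dominated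
convergence does the rest. -/
theorem continuous_integral_ite_le {A : Ω → ℝ} (hA : Measurable A)
    (hatom : ∀ c, P {ω | A ω = c} = 0) :
    Continuous fun l => ∫ ω, (if A ω ≤ l then (1 : ℝ) else 0) ∂P := by
  refine continuous_iff_continuousAt.2 fun c => ?_
  refine continuousAt_of_dominated (bound := fun _ => 1)
    (Filter.Eventually.of_forall fun l => (measurable_ite_le hA l).aestronglyMeasurable)
    (Filter.Eventually.of_forall fun l => ae_of_all _ fun ω => by split_ifs <;> simp)
    (integrable_const _) ?_
  have : ∀ᵐ ω ∂P, A ω ≠ c := by rw [ae_iff]; simpa using hatom c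
  filter_upwards [this] with ω hω
  rcases lt_or_gt_of_ne hω with h | h
  · refine continuousAt_const (y := (1 : ℝ)) |>.congr ?_
    filter_upwards [isOpen_Ioi.mem_nhds h] with l hl
    rw [if_pos (le_of_lt hl)]
  · refine continuousAt_const (y := (0 : ℝ)) |>.congr ?_
    filter_upwards [isOpen_Iio.mem_nhds h] with l hl
    rw [if_neg (not_le.2 hl)]

/-- Uniform control of the fluctuations of the counting process `#{i | A i ≤ l}`. -/
theorem exists_bound_counting_process {n : ℕ} (hn : 2 ≤ n) {A : Fin n → Ω → ℝ}
    (hA : ∀ i, Measurable (A i)) (hind : iIndepFun A P) (hatom : ∀ i c, P {ω | A i ω = c} = 0)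
    {Λ : ℝ} (hΛ : 0 ≤ Λ) :
    ∃ D : Ω → ℝ, Integrable D P ∧
      ∫ ω, D ω ∂P ≤ 1 + 2 * (Real.sqrt n * Real.log n) + 4 * Real.sqrt n ∧
      ∀ l ∈ Set.Icc 0 Λ, ∀ ω, |∑ i, (if A i ω ≤ l then (1 : ℝ) else 0) -
        ∫ ω', ∑ i, (if A i ω' ≤ l then (1 : ℝ) else 0) ∂P| ≤ D ω := by
  set N : ℝ → Ω → ℝ := fun l ω => ∑ i, (if A i ω ≤ l then (1 : ℝ) else 0) with hN
  set F : ℝ → ℝ := fun l => ∫ ω, N l ω ∂P with hF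
  have hNmono : ∀ ω, Monotone fun l => N l ω := fun ω l l' h =>
    Finset.sum_le_sum fun i _ => by
      by_cases h1 : A i ω ≤ l
      · simp [h1, h1.trans h]
      · rw [if_neg h1]; split_ifs <;> simp
  have hNi : ∀ l, Integrable (N l) P := fun l =>
    integrable_finsetSum _ fun i _ => integrable_ite_le (hA i) l
  have hFeq : ∀ l, F l = ∑ i, ∫ ω, (if A i ω ≤ l then (1 : ℝ) else 0) ∂P := fun l =>
    integral_finsetSum _ fun i _ => integrable_ite_le (hA i) l
  have hFc : Continuous F := by
    rw [show F = fun l => ∑ i, ∫ ω, (if A i ω ≤ l then (1 : ℝ) else 0) ∂P from funext hFeq]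
    exact continuous_finsetSum _ fun i _ => continuous_integral_ite_le (hA i) (hatom i)
  have hFm : Monotone F := fun l l' h =>
    integral_mono (hNi l) (hNi l') fun ω => hNmono ω h
  have hF0 : ∀ l, 0 ≤ F l := fun l => integral_nonneg fun ω =>
    Finset.sum_nonneg fun i _ => by split_ifs <;> simp
  have hFn : ∀ l, F l ≤ n := fun l => by
    calc F l ≤ ∫ _ω, (n : ℝ) ∂P := integral_mono (hNi l) (integrable_const _) fun ω => by
          calc N l ω ≤ ∑ _i : Fin n, (1 : ℝ) :=
                Finset.sum_le_sum fun i _ => by split_ifs <;> simp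
            _ = n := by simp
      _ = n := by simp
  obtain ⟨s, -, hcard, hs⟩ := exists_finset_bracketing hFc n 0 Λ hΛ
    (by linarith [hFn Λ, hF0 0])
  set Z : ℝ → Ω → ℝ := fun l ω => N l ω - F l with hZ
  have hn0 : (0 : ℝ) < n := by exact_mod_cast (by omega : 0 < n)
  have hn2 : (2 : ℝ) ≤ n := by exact_mod_cast hn
  have hr : 0 < Real.sqrt n := Real.sqrt_pos.2 hn0
  -- Hoeffding's lemma for each indicator and independence give sub-Gaussian parameter `n / 4`, so
  -- at `±1/√n` the exponential moment is at most `exp (1/8) ≤ 2`.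
  have hsub : ∀ l, HasSubgaussianMGF (Z l) (∑ _i : Fin n, (‖(1 : ℝ) - 0‖₊ / 2) ^ 2) P := by
    intro l
    have h1 := HasSubgaussianMGF.sum_of_iIndepFun (μ := P) (s := Finset.univ)
      (X := fun i ω => (if A i ω ≤ l then (1 : ℝ) else 0) -
        ∫ ω', (if A i ω' ≤ l then (1 : ℝ) else 0) ∂P)
      (hind.comp (fun i x => (if x ≤ l then (1 : ℝ) else 0) -
        ∫ ω', (if A i ω' ≤ l then (1 : ℝ) else 0) ∂P)
        fun i => (measurable_ite_le measurable_id l).sub_const _)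
      (c := fun _ => (‖(1 : ℝ) - 0‖₊ / 2) ^ 2) fun i _ =>
        hasSubgaussianMGF_of_mem_Icc (measurable_ite_le (hA i) l).aemeasurable
          (ae_of_all _ fun ω => by split_ifs <;> simp)
    convert h1 using 1
    funext ω
    simp only [hZ, hN, hFeq, Finset.sum_sub_distrib]
  have hmgf : ∀ l, ∀ e : ℝ, e ^ 2 = 1 →
      ∫ ω, Real.exp (e / Real.sqrt n * Z l ω) ∂P ≤ 2 := fun l e he => by
    have h1 := (hsub l).mgf_le (e / Real.sqrt n)
    refine h1.trans ?_
    have h2 : ((∑ _i : Fin n, (‖(1 : ℝ) - 0‖₊ / 2) ^ 2 : NNReal) : ℝ) * (e / Real.sqrt n) ^ 2 / 2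
        = 1 / 8 := by
      rw [show (e / Real.sqrt n) ^ 2 = 1 / n by rw [div_pow, he, Real.sq_sqrt hn0.le]]
      push_cast
      simp
      field_simp
      norm_num
    rw [h2]
    have h3 : Real.exp (1 / 8) ≤ Real.exp (Real.log 2) :=
      Real.exp_le_exp.2 (by linarith [Real.log_two_gt_d9])
    rwa [Real.exp_log (by norm_num)] at h3
  have hint : ∀ l, ∀ e : ℝ, Integrable (fun ω => Real.exp (e / Real.sqrt n * Z l ω)) P :=
    fun l e => (hsub l).integrable_exp_mul _
  set c : ℝ := Real.sqrt n / n ^ 2 with hc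
  have hc0 : 0 ≤ c := by positivity
  -- This is `u + 1 ≤ exp u` at `u = z / √n - 2 log n`, multiplied by `√n`. Summing the exponentials
  -- over the grid bounds all its points at once; the factor `n⁻²` in `c` absorbs the `n + 2`
  -- summands, since `n + 2 ≤ n²` for `n ≥ 2`.
  have hexp : ∀ z : ℝ, z ≤ 2 * (Real.sqrt n * Real.log n) +
      c * Real.exp (1 / Real.sqrt n * z) := fun z => by
    have h1 := Real.add_one_le_exp (1 / Real.sqrt n * z - 2 * Real.log n)
    have h2 : Real.exp (1 / Real.sqrt n * z - 2 * Real.log n) =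
        Real.exp (1 / Real.sqrt n * z) / n ^ 2 := by
      rw [Real.exp_sub, ← Real.exp_log hn0, ← Real.exp_nat_mul, Real.exp_log hn0]; norm_num
    rw [h2] at h1
    have h3 := mul_le_mul_of_nonneg_left h1 hr.le
    have h4 : Real.sqrt n * (1 / Real.sqrt n * z - 2 * Real.log n + 1) =
        z - 2 * (Real.sqrt n * Real.log n) + Real.sqrt n := by field_simp
    rw [h4] at h3
    have h5 : Real.sqrt n * (Real.exp (1 / Real.sqrt n * z) / n ^ 2) =
        c * Real.exp (1 / Real.sqrt n * z) := by rw [hc]; ring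
    linarith
  have hG : ∀ l, Integrable (fun ω => Real.exp (1 / Real.sqrt n * Z l ω) +
      Real.exp (-1 / Real.sqrt n * Z l ω)) P := fun l => (hint l 1).add (hint l (-1))
  have hGs : Integrable (fun ω => c * ∑ p ∈ s, (Real.exp (1 / Real.sqrt n * Z p ω) +
      Real.exp (-1 / Real.sqrt n * Z p ω))) P :=
    (integrable_finsetSum _ fun p _ => hG p).const_mul _
  refine ⟨fun ω => 1 + 2 * (Real.sqrt n * Real.log n) + c * ∑ p ∈ s,
    (Real.exp (1 / Real.sqrt n * Z p ω) + Real.exp (-1 / Real.sqrt n * Z p ω)), ?_, ?_, ?_⟩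
  · exact (integrable_const _).add hGs
  · rw [integral_add (integrable_const _) hGs, integral_const_mul,
      integral_finsetSum _ fun p _ => hG p]
    have h1 : ∑ p ∈ s, ∫ ω, (Real.exp (1 / Real.sqrt n * Z p ω) +
        Real.exp (-1 / Real.sqrt n * Z p ω)) ∂P ≤ ∑ _p ∈ s, (4 : ℝ) :=
      Finset.sum_le_sum fun p _ => by
        rw [integral_add (hint p 1) (hint p (-1))]
        linarith [hmgf p 1 (by norm_num), hmgf p (-1) (by norm_num)]
    have h2 : ∑ _p ∈ s, (4 : ℝ) ≤ 4 * (n + 2) := by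
      rw [Finset.sum_const, nsmul_eq_mul]
      have : (s.card : ℝ) ≤ n + 2 := by exact_mod_cast hcard
      linarith
    have h3 : c * (4 * (n + 2)) ≤ 4 * Real.sqrt n := by
      rw [hc, div_mul_eq_mul_div, div_le_iff₀ (by positivity)]
      have : (n : ℝ) + 2 ≤ n ^ 2 := by nlinarith
      nlinarith
    have h4 := mul_le_mul_of_nonneg_left (h1.trans h2) hc0
    simp only [integral_const, probReal_univ, smul_eq_mul, one_mul]
    linarith
  · intro l hl ω
    -- Monotonicity gives `Z p - 1 ≤ N l - F l ≤ Z q + 1` on the bracket `p ≤ l ≤ q`; this is the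
    -- summand 1 in the bound.
    obtain ⟨p, hp, q, hq, hpl, hlq, hpq⟩ := hs l hl
    have hterm : ∀ r ∈ s, c * Real.exp (1 / Real.sqrt n * Z r ω) +
        c * Real.exp (-1 / Real.sqrt n * Z r ω) ≤ c * ∑ p ∈ s,
        (Real.exp (1 / Real.sqrt n * Z p ω) + Real.exp (-1 / Real.sqrt n * Z p ω)) :=
      fun r hr => by
        rw [← mul_add]
        exact mul_le_mul_of_nonneg_left (Finset.single_le_sum
          (f := fun p => Real.exp (1 / Real.sqrt n * Z p ω) + Real.exp (-1 / Real.sqrt n * Z p ω))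
          (fun i _ => by positivity) hr) hc0
    have hup := hexp (Z q ω)
    have hlo := hexp (-Z p ω)
    rw [show 1 / Real.sqrt n * -Z p ω = -1 / Real.sqrt n * Z p ω by ring] at hlo
    have hq1 := hterm q hq
    have hp1 := hterm p hp
    have hpos : ∀ x, 0 ≤ c * Real.exp x := fun x => by positivity
    have n1 := hNmono ω hlq
    have n2 := hNmono ω hpl
    have f1 := hFm hpl
    have f2 := hFm hlq
    have p1 := hpos (-1 / Real.sqrt n * Z q ω)
    have p2 := hpos (1 / Real.sqrt n * Z p ω)
    simp only [hZ] at hup hlo hq1 hp1 p1 p2 ⊢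
    change |N l ω - F l| ≤ _
    simp only at n1 n2
    rw [abs_le]
    constructor <;> linarith

end CountingProcess

/-! ### The oracle inequality from bias and fluctuation bounds -/

section Oracle

theorem sqrt_mul_log_cube_bounds {n : ℕ} (hn : 2 ≤ n) :
    Real.sqrt n ≤ 4 * Real.sqrt (n * Real.log n ^ 3) ∧
      Real.sqrt n * Real.log n ≤ 2 * Real.sqrt (n * Real.log n ^ 3) := by
  have hn2 : (2 : ℝ) ≤ n := by exact_mod_cast hn
  have hlog : (1 : ℝ) / 2 ≤ Real.log n := by
    linarith [Real.log_two_gt_d9, Real.log_le_log (by norm_num) hn2]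
  have hlog0 : 0 ≤ Real.log n := by linarith
  have hprod : 0 ≤ (n : ℝ) * Real.log n ^ 3 := by positivity
  have h2 : (1 : ℝ) / 4 ≤ Real.log n ^ 2 := by nlinarith
  have h3 : Real.log n ^ 2 ≤ 2 * Real.log n ^ 3 := by nlinarith [sq_nonneg (Real.log n)]
  have hn0 : (0 : ℝ) ≤ n := by linarith
  constructor
  · refine Real.sqrt_le_iff.2 ⟨by positivity, ?_⟩
    rw [mul_pow, Real.sq_sqrt hprod]
    nlinarith
  · refine abs_le_of_sq_le_sq' ?_ (by positivity) |>.2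
    rw [mul_pow, mul_pow, Real.sq_sqrt hprod, Real.sq_sqrt hn0]
    nlinarith

variable {Ω : Type*} [MeasurableSpace Ω] {P : Measure Ω} [IsProbabilityMeasure P]

theorem measurable_clip (l : ℝ) : Measurable (clip l) := (lipschitzWith_clip l).continuous.measurable

/-- Oracle inequality for a minimiser of an almost unbiased risk estimate, in coordinates. -/
theorem soft_oracle_inequality {n : ℕ} (hn : 2 ≤ n) {y : Fin n → Ω → ℝ} {θ : Fin n → ℝ}
    (hym : ∀ i, Measurable (y i)) (hyL : ∀ i, MemLp (y i) 2 P) (hind : iIndepFun y P)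
    {σ K C Λ b : ℝ} (hvar : ∀ i, ∫ ω, y i ω ^ 2 ∂P = σ ^ 2) (hσK : σ ^ 2 ≤ K)
    (hatom : ∀ i c, P {ω | |θ i + y i ω| = c} = 0) (hΛ : 0 ≤ Λ) (hΛC : Λ ^ 2 = C * Real.log n)
    (hb0 : 0 ≤ b) (hb1 : b ≤ 1) {loss sur : ℝ → Ω → ℝ}
    (hloss : ∀ l ω, loss l ω = ∑ i, (y i ω - clip l (θ i + y i ω)) ^ 2)
    (hsur : ∀ l ω, sur l ω = n * σ ^ 2 + ∑ i, min ((θ i + y i ω) ^ 2) (l ^ 2) -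
      2 * σ ^ 2 * ∑ i, (if |θ i + y i ω| ≤ l then (1 : ℝ) else 0))
    (hbias : ∀ l ∈ Set.Icc 0 Λ, |∫ ω, sur l ω ∂P - ∫ ω, loss l ω ∂P| ≤ b * ∫ ω, loss l ω ∂P)
    {lhat : Ω → ℝ} (hmem : ∀ᵐ ω ∂P, lhat ω ∈ Set.Icc 0 Λ)
    {l₀ : ℝ} (hl₀ : l₀ ∈ Set.Icc 0 Λ) (hmin : ∀ᵐ ω ∂P, sur (lhat ω) ω ≤ sur l₀ ω)
    (hint : Integrable (fun ω => loss (lhat ω) ω) P) :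
    (1 - b) * ∫ ω, loss (lhat ω) ω ∂P ≤ (1 + b) * ∫ ω, loss l₀ ω ∂P +
      (2 * (Real.sqrt n * (C * Real.log n)) +
        2 * K * (1 + 2 * (Real.sqrt n * Real.log n) + 4 * Real.sqrt n) +
        Real.sqrt n * (K + C * Real.log n)) := by
  have hxm : ∀ i, Measurable fun ω => θ i + y i ω := fun i => (hym i).const_add _
  have hAm : ∀ i, Measurable fun ω => |θ i + y i ω| := fun i =>
    continuous_abs.measurable.comp (hxm i)
  have hn0 : (0 : ℝ) ≤ n := n.cast_nonneg
  -- the three fluctuation bounds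
  obtain ⟨Da, hDai, hDa, hDab⟩ := exists_bound_integrated_process (P := P)
    (W := fun (_ : Fin n) _ => (1 : ℝ)) (A := fun i ω => |θ i + y i ω|)
    (fun _ => measurable_const) hAm (fun _ => memLp_const 1)
    (hind.comp (fun i s => ((1 : ℝ), |θ i + s|)) fun i => by fun_prop) (v := 1)
    (fun _ => by simp) (k := fun t => 2 * t) (by fun_prop) Λ
  obtain ⟨Db, hDbi, hDb, hDbb⟩ := exists_bound_integrated_process (P := P)
    (W := fun i ω => y i ω * Real.sign (θ i + y i ω)) (A := fun i ω => |θ i + y i ω|)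
    (fun i => (hym i).mul (measurable_sign.comp (hxm i))) hAm
    (fun i => (hyL i).mono ((hym i).mul (measurable_sign.comp (hxm i))).aestronglyMeasurable
      (ae_of_all _ fun ω => by
        simpa [abs_mul] using mul_le_of_le_one_right (abs_nonneg (y i ω)) (abs_sign_le_one _)))
    (hind.comp (fun i s => (s * Real.sign (θ i + s), |θ i + s|)) fun i =>
      (measurable_id.mul (measurable_sign.comp (measurable_id.const_add _))).prodMk
        (by fun_prop)) (v := σ ^ 2)
    (fun i => by
      rw [← hvar i]
      refine integral_mono_of_nonneg (ae_of_all _ fun ω => sq_nonneg _) (hyL i).integrable_sq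
        (ae_of_all _ fun ω => ?_)
      refine sq_le_sq.2 ?_
      simpa [abs_mul] using mul_le_of_le_one_right (abs_nonneg (y i ω)) (abs_sign_le_one _))
    (k := fun _ => 1) continuous_const Λ
  obtain ⟨Dc, hDci, hDc, hDcb⟩ := exists_bound_counting_process (P := P) hn hAm
    (hind.comp (fun i s => |θ i + s|) fun i => by fun_prop) hatom hΛ
  have hDa' : ∫ ω, Da ω ∂P ≤ Real.sqrt n * (C * Real.log n) := by
    refine hDa.trans (le_of_eq ?_)
    rw [mul_one, ← hΛC, ← setIntegral_Ioc_id hΛ]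
    congr 1
    refine setIntegral_congr_fun measurableSet_Ioc fun t ht => ?_
    exact abs_of_nonneg (by linarith [ht.1])
  have hDb' : 2 * ∫ ω, Db ω ∂P ≤ Real.sqrt n * (K + C * Real.log n) := by
    have h1 : ∫ t in Set.Ioc 0 Λ, |(1 : ℝ)| = Λ := by simp [hΛ]
    rw [h1, Real.sqrt_mul hn0, Real.sqrt_sq_eq_abs] at hDb
    -- Arithmetic-geometric mean inequality, with `σ² ≤ K` and `Λ² = C log n`.
    have h2 : 2 * (|σ| * Λ) ≤ K + C * Real.log n := by
      nlinarith [sq_nonneg (|σ| - Λ), sq_abs σ]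
    nlinarith [mul_le_mul_of_nonneg_left h2 (Real.sqrt_nonneg n)]
  -- the three processes
  set Na : ℝ → Ω → ℝ := fun l ω => ∑ i, min ((θ i + y i ω) ^ 2) (l ^ 2) with hNa
  set Nb : ℝ → Ω → ℝ := fun l ω => ∑ i, y i ω * clip l (θ i + y i ω) with hNb
  set Nc : ℝ → Ω → ℝ := fun l ω => ∑ i, (if |θ i + y i ω| ≤ l then (1 : ℝ) else 0) with hNc
  set Q : Ω → ℝ := fun ω => ∑ i, y i ω ^ 2 with hQ
  have fa : ∀ l ∈ Set.Icc 0 Λ, ∀ ω, |Na l ω - ∫ ω', Na l ω' ∂P| ≤ Da ω := fun l hl ω => by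
    simpa only [hNa, min_sq_eq_setIntegral hl.1, one_mul] using hDab l hl ω
  have fb : ∀ l ∈ Set.Icc 0 Λ, ∀ ω, |Nb l ω - ∫ ω', Nb l ω' ∂P| ≤ Db ω := fun l hl ω => by
    simpa only [hNb, clip_eq_setIntegral hl.1, ← mul_assoc] using hDbb l hl ω
  have ia : ∀ l, Integrable (Na l) P := fun l =>
    integrable_finsetSum _ fun i _ => (integrable_const (l ^ 2)).mono'
      (((hxm i).pow_const 2).min measurable_const).aestronglyMeasurable
      (ae_of_all _ fun ω => by
        rw [Real.norm_of_nonneg (le_min (sq_nonneg _) (sq_nonneg _))]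
        exact min_le_right _ _)
  have ib : ∀ l ∈ Set.Icc 0 Λ, Integrable (Nb l) P := fun l hl =>
    integrable_finsetSum _ fun i _ =>
      ((hyL i).integrable (by norm_num)).mul_bdd (c := l)
        ((measurable_clip l).comp (hxm i)).aestronglyMeasurable
        (ae_of_all _ fun ω => abs_clip_le hl.1 _)
  have ic : ∀ l, Integrable (Nc l) P := fun l =>
    integrable_finsetSum _ fun i _ => integrable_ite_le (hAm i) l
  have iq : Integrable Q P := integrable_finsetSum _ fun i _ => (hyL i).integrable_sq
  have hQE : ∫ ω, Q ω ∂P = n * σ ^ 2 := by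
    rw [integral_finsetSum _ fun i _ => (hyL i).integrable_sq]
    simp [hvar]
  have hlossN : ∀ l, 0 ≤ l → ∀ ω, loss l ω = Q ω - 2 * Nb l ω + Na l ω := fun l hl ω => by
    rw [hloss]
    simp only [hQ, hNb, hNa, Finset.mul_sum, ← Finset.sum_sub_distrib, ← Finset.sum_add_distrib]
    refine Finset.sum_congr rfl fun i _ => ?_
    rw [← clip_sq hl]; ring
  have hrisk : ∀ l ∈ Set.Icc 0 Λ, ∫ ω, loss l ω ∂P =
      n * σ ^ 2 - 2 * ∫ ω, Nb l ω ∂P + ∫ ω, Na l ω ∂P := fun l hl => by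
    have i1 : Integrable (fun ω => Q ω - 2 * Nb l ω) P := iq.sub ((ib l hl).const_mul 2)
    simp_rw [hlossN l hl.1]
    rw [integral_add i1 (ia l),
      integral_sub iq ((ib l hl).const_mul 2), integral_const_mul, hQE]
  have isur : ∀ l, Integrable (sur l) P := fun l => by
    rw [show sur l = fun ω => n * σ ^ 2 + Na l ω - 2 * σ ^ 2 * Nc l ω from funext (hsur l)]
    exact ((integrable_const _).add (ia l)).sub ((ic l).const_mul _)
  have hsurE : ∀ l, ∫ ω, sur l ω ∂P =
      n * σ ^ 2 + ∫ ω, Na l ω ∂P - 2 * σ ^ 2 * ∫ ω, Nc l ω ∂P := fun l => by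
    have i1 : Integrable (fun ω => n * σ ^ 2 + Na l ω) P := (integrable_const _).add (ia l)
    have e1 : ∀ ω, sur l ω = n * σ ^ 2 + Na l ω - 2 * σ ^ 2 * Nc l ω := hsur l
    simp_rw [e1]
    rw [integral_sub i1 ((ic l).const_mul _),
      integral_add (integrable_const _) (ia l)]
    simp [integral_const_mul]
  -- The bias bound concerns the deterministic risk function, so it may be evaluated at the random
  -- value `lhat ω`. The chain runs from the loss to its mean function, to the mean of SURE, to SURE
  -- itself, and by minimality to SURE at `l₀`. `Da` is paid twice, once for the loss and once for
  -- SURE.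
  have key : ∀ᵐ ω ∂P, (1 - b) * loss (lhat ω) ω ≤ sur l₀ ω + (1 - b) * (Q ω - n * σ ^ 2) +
      (2 * Da ω + 2 * σ ^ 2 * Dc ω + 2 * Db ω) := by
    filter_upwards [hmem, hmin] with ω hω hm
    have a1 := fa _ hω ω
    have b1 := fb _ hω ω
    have c1 := hDcb _ hω ω
    change |Nc (lhat ω) ω - ∫ ω', Nc (lhat ω) ω' ∂P| ≤ Dc ω at c1
    have hDa0 : 0 ≤ Da ω := (abs_nonneg _).trans a1
    have hDb0 : 0 ≤ Db ω := (abs_nonneg _).trans b1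
    have h1 := (abs_le.1 (hbias _ hω)).1
    have h2 := hsurE (lhat ω)
    have h3 := hsur (lhat ω) ω
    change sur (lhat ω) ω = n * σ ^ 2 + Na (lhat ω) ω - 2 * σ ^ 2 * Nc (lhat ω) ω at h3
    have h4 := hlossN _ hω.1 ω
    have h5 := hrisk _ hω
    have c2 := mul_le_mul_of_nonneg_left (abs_le.1 c1).2 (by positivity : 0 ≤ 2 * σ ^ 2)
    have h6 : (1 - b) * ∫ ω', loss (lhat ω) ω' ∂P ≤ sur l₀ ω + Da ω + 2 * σ ^ 2 * Dc ω := by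
      linarith [(abs_le.1 a1).1]
    have h7 : loss (lhat ω) ω ≤ ∫ ω', loss (lhat ω) ω' ∂P + (Q ω - n * σ ^ 2) +
        (2 * Db ω + Da ω) := by
      linarith [(abs_le.1 a1).2, (abs_le.1 b1).1]
    have h8 := mul_le_mul_of_nonneg_left h7 (by linarith : 0 ≤ 1 - b)
    -- Allows the factor `1 - b` on the fluctuations to be replaced by 1. It stays on `Q - n σ²`,
    -- which has no sign but integrates to zero.
    have h9 : 0 ≤ b * (2 * Db ω + Da ω) := by positivity
    nlinarith
  have iQ : Integrable (fun ω => Q ω - n * σ ^ 2) P := iq.sub (integrable_const _)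
  have iac : Integrable (fun ω => 2 * Da ω + 2 * σ ^ 2 * Dc ω) P :=
    (hDai.const_mul _).add (hDci.const_mul _)
  have iR1 : Integrable (fun ω => sur l₀ ω + (1 - b) * (Q ω - n * σ ^ 2)) P :=
    (isur l₀).add (iQ.const_mul _)
  have iR2 : Integrable (fun ω => 2 * Da ω + 2 * σ ^ 2 * Dc ω + 2 * Db ω) P :=
    iac.add (hDbi.const_mul _)
  have hfin := integral_mono_ae (hint.const_mul (1 - b)) (iR1.add iR2) key
  simp only [Pi.add_apply] at hfin
  rw [integral_const_mul, integral_add iR1 iR2,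
    integral_add (isur l₀) (iQ.const_mul _), integral_const_mul,
    integral_sub iq (integrable_const _), hQE,
    integral_add iac (hDbi.const_mul _),
    integral_add (hDai.const_mul _) (hDci.const_mul _)] at hfin
  simp only [integral_const_mul, integral_const, probReal_univ, smul_eq_mul, one_mul, sub_self, mul_zero,
    add_zero] at hfin
  have h10 := (abs_le.1 (hbias _ hl₀)).2
  have hlog : 0 ≤ Real.log n := Real.log_natCast_nonneg n
  have hc0 : 0 ≤ 1 + 2 * (Real.sqrt n * Real.log n) + 4 * Real.sqrt n := by positivity
  have h11 : 2 * σ ^ 2 * ∫ ω, Dc ω ∂P ≤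
      2 * K * (1 + 2 * (Real.sqrt n * Real.log n) + 4 * Real.sqrt n) :=
    (mul_le_mul_of_nonneg_left hDc (by positivity)).trans
      (mul_le_mul_of_nonneg_right (by linarith) hc0)
  linarith

end Oracle

/-! ### Consequences of the density and of the Stein kernel -/

section Noise

variable {d : ℕ} {ν : Measure (EuclideanSpace ℝ (Fin d))}

/-- The density is positive everywhere. Absolute continuity in one direction rules out atoms of
`|X_i|`, in the other it makes the denominators of the tail ratios positive. -/
theorem IsStronglyLogConcave.absolutelyContinuous (h : IsStronglyLogConcave ν) :
    ν ≪ volume ∧ volume ≪ ν := by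
  obtain ⟨m, hm, φ, hφ, rfl⟩ := h
  refine ⟨withDensity_absolutelyContinuous _ _, withDensity_absolutelyContinuous' ?_ ?_⟩
  · have hc : Continuous φ := by
      simpa [continuousOn_univ] using
        (hφ.strictConvexOn hm).convexOn.continuousOn isOpen_univ
    fun_prop
  · exact ae_of_all _ fun x => by simpa using Real.exp_pos _

theorem measure_abs_coord_eq_zero (hν : ν ≪ volume) (i : Fin d) (t c : ℝ) :
    ν {y | |t + y i| = c} = 0 := by
  refine hν (measure_mono_null (fun y hy => ?_)
    (volume_coord_mem_eq_zero i (Set.toFinite {c - t, -c - t}).countable))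
  rcases eq_or_eq_neg_of_abs_eq hy with h | h
  · left; linarith
  · right; simp only [Set.mem_singleton_iff]; linarith

theorem measureReal_lt_abs_coord_pos [IsFiniteMeasure ν] (hν : volume ≪ ν) (i : Fin d) (t c : ℝ) :
    0 < ν.real {y | c < |t + y i|} := by
  have ho : IsOpen {y : EuclideanSpace ℝ (Fin d) | c < |t + y i|} :=
    isOpen_lt continuous_const ((continuous_const.add (continuous_coord i)).abs)
  have hne : ({y : EuclideanSpace ℝ (Fin d) | c < |t + y i|}).Nonempty := by
    refine ⟨EuclideanSpace.single i (|c| + |t| + 1), ?_⟩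
    simp only [Set.mem_ofPred_eq, PiLp.single_apply, if_true]
    have h1 := le_abs_self (t + (|c| + |t| + 1))
    linarith [neg_abs_le t, le_abs_self c]
  refine ENNReal.toReal_pos (fun h0 => (ho.measure_pos volume hne).ne' (hν h0))
    (measure_ne_top _ _)

/-- The bias of Stein's unbiased risk estimate in one coordinate. -/
theorem IsSteinKernel.abs_clip_bias_le [IsProbabilityMeasure ν]
    {T : EuclideanSpace ℝ (Fin d) → Matrix (Fin d) (Fin d) ℝ} (hT : IsSteinKernel ν T)
    (i : Fin d) {s L : ℝ} (hL2 : MemLp (fun y : EuclideanSpace ℝ (Fin d) => y i) 2 ν)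
    (hs : ∫ y : EuclideanSpace ℝ (Fin d), y i ^ 2 ∂ν = s)
    (hTL : ∀ᵐ y ∂ν, |s - T y i i| ≤ L) (t : ℝ) {l : ℝ} (hl : 0 ≤ l) :
    |∫ y, y i * clip l (t + y i) ∂ν - s * ∫ y, (if |t + y i| ≤ l then (1 : ℝ) else 0) ∂ν| ≤
      L * ν.real {y | l < |t + y i|} := by
  have hxm : Measurable fun y : EuclideanSpace ℝ (Fin d) => t + y i :=
    (measurable_coord i).const_add t
  have hAm : Measurable fun y : EuclideanSpace ℝ (Fin d) => |t + y i| :=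
    continuous_abs.measurable.comp hxm
  have hTi : Integrable (fun y => T y i i) ν := (hT.1 i i).integrable (by norm_num)
  have hTs : Integrable (fun y => T y i i - s) ν := hTi.sub (integrable_const s)
  -- The Stein identity for the linear field says that the mean of `T_ii` is the variance. This lets
  -- the error on `{|x_i| ≤ l}` be traded for the one on the complementary tail.
  have h0 : ∫ y, (T y i i - s) ∂ν = 0 := by
    have h := hT.coord i (g := fun x => x) (g' := fun _ => 1) hL2 (memLp_const 1)
      (isWeakPartial_coord_of_hasDerivAt (fun x => hasDerivAt_id x) continuous_const i)
    simp only [mul_one, ← sq, hs] at h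
    rw [integral_sub hTi (integrable_const s), ← h]
    simp
  have hind : Measurable fun x : ℝ => if |t + x| ≤ l then (1 : ℝ) else 0 :=
    measurable_ite_le (by fun_prop) l
  have h1 : ∫ y, y i * clip l (t + y i) ∂ν =
      ∫ y, T y i i * (if |t + y i| ≤ l then (1 : ℝ) else 0) ∂ν := by
    refine hT.coord i (g := fun x => clip l (t + x)) (g' := fun x => if |t + x| ≤ l then 1 else 0)
      ?_ ?_ ?_
    · exact MemLp.of_bound ((measurable_clip l).comp hxm).aestronglyMeasurable l
        (ae_of_all _ fun y => abs_clip_le hl _)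
    · exact MemLp.of_bound (hind.comp (measurable_coord i)).aestronglyMeasurable 1
        (ae_of_all _ fun y => by split_ifs <;> simp)
    · refine fun j => isWeakPartial_coord_of_lipschitz (g := fun x => clip l (t + x)) (K := 1)
        (N := {x | |t + x| = l}) (b := 1) ?_ ?_ ?_ hind ?_ i j
      · simpa [Function.comp_def] using (lipschitzWith_clip l).comp (IsometryEquiv.addLeft t).isometry.lipschitz
      · refine (Set.toFinite {l - t, -l - t}).countable.mono fun x hx => ?_
        rcases eq_or_eq_neg_of_abs_eq hx with h | h
        · left; linarith
        · right; simp only [Set.mem_singleton_iff]; linarith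
      · intro x hx
        simpa using (hasDerivAt_clip hl hx).comp_const_add t x
      · intro x; split_ifs <;> simp
  have hite := integrable_ite_le (P := ν) hAm l
  have hTite : Integrable (fun y => T y i i * (if |t + y i| ≤ l then (1 : ℝ) else 0)) ν :=
    hTi.mul_bdd (c := 1) (measurable_ite_le hAm l).aestronglyMeasurable
      (ae_of_all _ fun y => by split_ifs <;> simp)
  have hms : MeasurableSet {y : EuclideanSpace ℝ (Fin d) | l < |t + y i|} :=
    measurableSet_lt measurable_const hAm
  have h2 : ∫ y, T y i i * (if |t + y i| ≤ l then (1 : ℝ) else 0) ∂ν -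
      s * ∫ y, (if |t + y i| ≤ l then (1 : ℝ) else 0) ∂ν =
      - ∫ y in {y | l < |t + y i|}, (T y i i - s) ∂ν := by
    have h3 := integral_add_compl hms hTs
    have h4 : ∫ y, (T y i i * (if |t + y i| ≤ l then (1 : ℝ) else 0) -
        s * (if |t + y i| ≤ l then (1 : ℝ) else 0)) ∂ν =
        ∫ y in {y | l < |t + y i|}ᶜ, (T y i i - s) ∂ν := by
      rw [← integral_indicator hms.compl]
      congr 1
      funext y
      by_cases h : |t + y i| ≤ l <;> simp [Set.indicator, h]
    rw [← integral_const_mul, ← integral_sub hTite (hite.const_mul s), h4]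
    linarith
  rw [h1, h2, abs_neg, ← Real.norm_eq_abs]
  refine norm_setIntegral_le_of_norm_le_const_ae' (measure_lt_top _ _) ?_
  filter_upwards [hTL] with y hy _
  rwa [Real.norm_eq_abs, abs_sub_comm]

end Noise

/-! ### Integrability, continuity and a lower bound of the risk -/

section Risk

variable {Ω : Type*} [MeasurableSpace Ω] {P : Measure Ω} [IsProbabilityMeasure P]

theorem sq_sub_clip_le {l Λ : ℝ} (hl : l ∈ Set.Icc 0 Λ) (y x : ℝ) :
    (y - clip l x) ^ 2 ≤ 2 * y ^ 2 + 2 * Λ ^ 2 := by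
  have h1 : clip l x ^ 2 ≤ Λ ^ 2 := by
    rw [clip_sq hl.1]
    exact (min_le_right _ _).trans (pow_le_pow_left₀ hl.1 hl.2 2)
  nlinarith [sq_nonneg (y + clip l x)]

theorem integrable_soft_loss {n : ℕ} {y : Fin n → Ω → ℝ} (hym : ∀ i, Measurable (y i))
    (hyL : ∀ i, MemLp (y i) 2 P) (θ : Fin n → ℝ) {Λ : ℝ} {lam : Ω → ℝ} (hlam : Measurable lam)
    (hmem : ∀ᵐ ω ∂P, lam ω ∈ Set.Icc 0 Λ) (i : Fin n) :
    Integrable (fun ω => (y i ω - clip (lam ω) (θ i + y i ω)) ^ 2) P := by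
  refine (((hyL i).integrable_sq.const_mul 2).add (integrable_const (2 * Λ ^ 2))).mono'
    (((hym i).sub (continuous_clip_uncurry.measurable.comp
      (hlam.prodMk ((hym i).const_add _)))).pow_const 2).aestronglyMeasurable ?_
  filter_upwards [hmem] with ω hω
  rw [Real.norm_of_nonneg (sq_nonneg _)]
  exact sq_sub_clip_le hω _ _

theorem continuousOn_soft_risk {n : ℕ} {y : Fin n → Ω → ℝ} (hym : ∀ i, Measurable (y i))
    (hyL : ∀ i, MemLp (y i) 2 P) (θ : Fin n → ℝ) (Λ : ℝ) :
    ContinuousOn (fun l => ∫ ω, ∑ i, (y i ω - clip l (θ i + y i ω)) ^ 2 ∂P) (Set.Icc 0 Λ) := by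
  refine continuousOn_of_dominated (bound := fun ω => ∑ i, (2 * y i ω ^ 2 + 2 * Λ ^ 2)) ?_ ?_ ?_ ?_
  · intro l _
    exact (Finset.measurable_fun_sum _ fun i _ => ((hym i).sub ((measurable_clip l).comp
      ((hym i).const_add _))).pow_const 2).aestronglyMeasurable
  · intro l hl
    refine ae_of_all _ fun ω => ?_
    rw [Real.norm_of_nonneg (Finset.sum_nonneg fun i _ => sq_nonneg _)]
    exact Finset.sum_le_sum fun i _ => sq_sub_clip_le hl _ _
  · exact integrable_finsetSum _ fun i _ =>
      ((hyL i).integrable_sq.const_mul 2).add (integrable_const _)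
  · refine ae_of_all _ fun ω => Continuous.continuousOn ?_
    refine continuous_finsetSum _ fun i _ => (continuous_const.sub ?_).pow 2
    exact continuous_clip_uncurry.comp (continuous_id.prodMk continuous_const)

/-- When `|x| > l + A + 1`, thresholding moves `x` by at most `l`, so the estimate is still more
than 1 away from `t`, where `|t| ≤ A`. -/
theorem measureReal_lt_le_soft_risk {y : Ω → ℝ} (hym : Measurable y) {t l A : ℝ} (hl : 0 ≤ l)
    (hA : |t| ≤ A) (hint : Integrable (fun ω => (y ω - clip l (t + y ω)) ^ 2) P) :
    P.real {ω | l + A + 1 < |t + y ω|} ≤ ∫ ω, (y ω - clip l (t + y ω)) ^ 2 ∂P := by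
  have hms : MeasurableSet {ω | l + A + 1 < |t + y ω|} :=
    measurableSet_lt measurable_const (continuous_abs.measurable.comp (hym.const_add t))
  rw [← integral_indicator_one hms]
  refine integral_mono ((integrable_const (1 : ℝ)).indicator hms) hint fun ω => ?_
  by_cases h : l + A + 1 < |t + y ω|
  · have hA0 : 0 ≤ A := (abs_nonneg t).trans hA
    have h1 : 1 ≤ |y ω - clip l (t + y ω)| := by
      have h2 := abs_sub_abs_le_abs_sub (t + y ω) (t + clip l (t + y ω))
      have h3 := abs_add_le t (clip l (t + y ω))
      have h4 := abs_clip_le hl (t + y ω)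
      rw [show t + y ω - (t + clip l (t + y ω)) = y ω - clip l (t + y ω) by ring] at h2
      linarith
    have h5 : (1 : ℝ) ≤ (y ω - clip l (t + y ω)) ^ 2 := by
      rw [← sq_abs]; nlinarith
    simpa [Set.indicator, h] using h5
  · simpa [Set.indicator, h] using sq_nonneg _

end Risk

/-! ### The main theorem -/

theorem theorem4p3 (C : ℝ) (hC : 0 < C) :
    ∃ B : ℝ, 0 < B ∧
      ∀ (d : ℕ) (Ω : Type*) [MeasurableSpace Ω] (P : Measure Ω) [IsProbabilityMeasure P]
        (σ : ℝ) (θ : EuclideanSpace ℝ (Fin d)) (X Y : Ω → EuclideanSpace ℝ (Fin d))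
        (T : EuclideanSpace ℝ (Fin d) → Matrix (Fin d) (Fin d) ℝ) (L M : ℝ) (lhat : Ω → ℝ),
        1 ≤ d → 0 < σ →
        -- the observation is `X = θ + Y`
        Measurable Y → (∀ ω, X ω = θ + Y ω) →
        -- the noise `Y`: strongly log-concave, independent coordinates, mean `0`, covariance `σ² Id`
        IsStronglyLogConcave (P.map Y) →
        iIndepFun (fun (i : Fin d) ω => Y ω i) P →
        (∀ i, ∫ ω, Y ω i ∂P = 0) →
        (∀ i j, cov[fun ω => Y ω i, fun ω => Y ω j; P] = if i = j then σ ^ 2 else 0) →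
        -- `C` is a sub-Gaussian scaling constant of `Y`
        (∃ a : ℝ, 0 < a ∧ ∀ t : ℝ, 0 < t →
          P.real {ω | t ≤ ‖Y ω‖} ≤ a * Real.exp (-t ^ 2 / C)) →
        -- the constants `L` and `M`
        IsSteinKernel (P.map Y) T →
        0 ≤ L → (∀ᵐ ω ∂P, ∀ i, |σ ^ 2 - T (Y ω) i i| ≤ L) →
        IsLUB (tailRatios P C θ X) M →
        L * M < 1 / 2 →
        -- the data-driven threshold minimises SURE over `I`
        Measurable lhat →
        (∀ᵐ ω ∂P, lhat ω ∈ thresholdRange C d ∧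
          IsMinOn (fun l => softSure σ l (X ω)) (thresholdRange C d) (lhat ω)) →
        -- all risks are finite, the minimal risk is attained, and the oracle inequality holds
        Integrable (fun ω => softLoss θ (lhat ω) (X ω)) P ∧
        (∀ l ∈ thresholdRange C d, Integrable (fun ω => softLoss θ l (X ω)) P) ∧
        ∃ R : ℝ, IsLeast ((fun l => ∫ ω, softLoss θ l (X ω) ∂P) '' thresholdRange C d) R ∧
          (1 - 2 * (L * M)) * ∫ ω, softLoss θ (lhat ω) (X ω) ∂P
            ≤ (1 + 2 * (L * M)) * R + B * Real.sqrt (d * Real.log d ^ 3) := by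
  -- Put `K = C + 1/2 ≥ σ²` and `S = √(d log³ d)`. With `1 ≤ √d ≤ 4S` and `√d log d ≤ 2S`, the
  -- remainder of `soft_oracle_inequality` contributes `4 + 2` times `C S` and `8 + 8 + 32 + 4`
  -- times `K S`.
  refine ⟨6 * C + 52 * (C + 1 / 2), by positivity, ?_⟩
  intro d Ω _ P _ σ θ X Y T L M lhat hd hσ hYm hX hlc hindep hmean hcov htail hT hL0 hTL hM hLM
    hlm hlhat
  have : IsProbabilityMeasure (P.map Y) := Measure.isProbabilityMeasure_map hYm.aemeasurable
  obtain ⟨hac, hac'⟩ := hlc.absolutelyContinuous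
  set y : Fin d → Ω → ℝ := fun i ω => Y ω i with hy
  have hym : ∀ i, Measurable (y i) := fun i => (measurable_coord i).comp hYm
  have hXi : ∀ ω i, X ω i = θ i + y i ω := fun ω i => by rw [hX]; rfl
  set Λ : ℝ := Real.sqrt (C * Real.log d) with hΛ
  have hrange : thresholdRange C d = Set.Icc 0 Λ := rfl
  have hΛ0 : 0 ≤ Λ := Real.sqrt_nonneg _
  -- moments of the noise
  have hexp : ∀ i, Integrable (fun ω => Real.exp (y i ω ^ 2 / (2 * C))) P := fun i => by
    obtain ⟨a, -, ha⟩ := htail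
    have h1 := integrable_exp_sq_of_tail hYm.norm (fun ω => norm_nonneg _) hC ha
    refine h1.mono' (by fun_prop) (ae_of_all _ fun ω => ?_)
    rw [Real.norm_of_nonneg (Real.exp_pos _).le]
    refine Real.exp_le_exp.2 (div_le_div_of_nonneg_right ?_ (by positivity))
    exact sq_le_sq.2 (by
      simpa [abs_of_nonneg (norm_nonneg (Y ω))] using PiLp.norm_apply_le (Y ω) i)
  have hyL : ∀ i, MemLp (y i) 2 P := fun i => by
    simpa using memLp_two_pow_of_integrable_exp_sq (hym i).aestronglyMeasurable hC (hexp i) 1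
  have hvar : ∀ i, ∫ ω, y i ω ^ 2 ∂P = σ ^ 2 := fun i => by
    have h1 := hcov i i
    rw [if_pos rfl, covariance_self (hym i).aemeasurable,
      variance_of_integral_eq_zero (hym i).aemeasurable (hmean i)] at h1
    exact h1
  -- `T` is only almost everywhere measurable for the law of `Y`, so the transfer goes through null
  -- measurable sets.
  have hTL' : ∀ᵐ z ∂(P.map Y), ∀ i, |σ ^ 2 - T z i i| ≤ L := by
    have hTi : ∀ i, AEMeasurable (fun z => T z i i) (P.map Y) := fun i =>
      (hT.1 i i).aestronglyMeasurable.aemeasurable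
    refine ae_all_iff.2 fun i => ?_
    have hn : NullMeasurableSet {z | |σ ^ 2 - T z i i| ≤ L} (P.map Y) :=
      nullMeasurableSet_le (continuous_abs.measurable.comp_aemeasurable
        (aemeasurable_const.sub (hTi i))) aemeasurable_const
    rw [ae_iff]
    change (P.map Y) {z | |σ ^ 2 - T z i i| ≤ L}ᶜ = 0
    rw [Measure.map_apply₀ hYm.aemeasurable hn.compl]
    exact ae_iff.1 (ae_all_iff.1 hTL i)
  have hν2 : ∀ i, MemLp (fun z : EuclideanSpace ℝ (Fin d) => z i) 2 (P.map Y) := fun i =>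
    (memLp_map_measure_iff (measurable_coord i).aestronglyMeasurable hYm.aemeasurable).2 (hyL i)
  have hνvar : ∀ i, ∫ z : EuclideanSpace ℝ (Fin d), z i ^ 2 ∂(P.map Y) = σ ^ 2 := fun i => by
    rw [integral_map hYm.aemeasurable ((measurable_coord i).pow_const 2).aestronglyMeasurable]
    exact hvar i
  -- tail ratios
  set A : ℝ := ⨆ k, |θ k| with hA
  have hθA : ∀ i, |θ i| ≤ A := fun i =>
    le_ciSup (f := fun k => |θ k|) (Set.finite_range _).bddAbove i
  have hmap : ∀ (i : Fin d) (c : ℝ), P.real {ω | c < |θ i + y i ω|} =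
      (P.map Y).real {z | c < |θ i + z i|} := fun i c =>
    (map_measureReal_apply hYm (measurableSet_lt measurable_const
      (continuous_abs.measurable.comp ((measurable_coord i).const_add _)))).symm
  -- Division by zero would make a tail ratio 0 and its bound by `M` empty; positive denominators
  -- exclude this.
  have hpos : ∀ (i : Fin d) (c : ℝ), 0 < P.real {ω | c < |θ i + y i ω|} := fun i c => by
    rw [hmap]; exact measureReal_lt_abs_coord_pos hac' i _ _
  have hratio : ∀ l ∈ Set.Icc 0 Λ, ∀ i, P.real {ω | l < |θ i + y i ω|} ≤
      M * P.real {ω | l + A + 1 < |θ i + y i ω|} := fun l hl i => by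
    rw [← div_le_iff₀ (hpos i _)]
    refine hM.1 ⟨l, hl, i, ?_⟩
    simp only [hXi, hA]
  have hM1 : 1 ≤ M := by
    have i : Fin d := ⟨0, hd⟩
    have h1 := hratio 0 ⟨le_rfl, hΛ0⟩ i
    have hA0 : 0 ≤ A := (abs_nonneg _).trans (hθA i)
    have h2 : P.real {ω | 0 + A + 1 < |θ i + y i ω|} ≤ P.real {ω | 0 < |θ i + y i ω|} :=
      measureReal_mono fun ω (hω : 0 + A + 1 < _) => show (0 : ℝ) < _ by linarith
    have h3 := hpos i (0 + A + 1)
    by_contra! h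
    nlinarith
  have hM0 : 0 ≤ M := by linarith
  have hLM0 : 0 ≤ L * M := mul_nonneg hL0 hM0
  -- From `L ≤ L * M < 1/2`; it turns `σ² ≤ C + L` into a bound in `C` alone.
  have hL2 : L ≤ 1 / 2 := by nlinarith
  -- losses in coordinates
  have hlossY : ∀ l, 0 ≤ l → ∀ ω, softLoss θ l (X ω) =
      ∑ i, (y i ω - clip l (θ i + y i ω)) ^ 2 := fun l hl ω => by
    rw [softLoss, EuclideanSpace.norm_sq_eq]
    refine Finset.sum_congr rfl fun i _ => ?_
    rw [Real.norm_eq_abs, sq_abs, PiLp.sub_apply, softThreshold_apply hl, hXi]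
    ring
  set loss : ℝ → Ω → ℝ := fun l ω => ∑ i, (y i ω - clip l (θ i + y i ω)) ^ 2 with hloss
  have hlossI : ∀ l ∈ Set.Icc 0 Λ, ∀ i,
      Integrable (fun ω => (y i ω - clip l (θ i + y i ω)) ^ 2) P := fun l hl i =>
    integrable_soft_loss hym hyL θ measurable_const (ae_of_all _ fun _ => hl) i
  have hmem : ∀ᵐ ω ∂P, lhat ω ∈ Set.Icc 0 Λ := hlhat.mono fun ω h => h.1
  have hhat : (fun ω => softLoss θ (lhat ω) (X ω)) =ᵐ[P] fun ω => loss (lhat ω) ω :=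
    hmem.mono fun ω h => hlossY _ h.1 ω
  have hhatI : Integrable (fun ω => loss (lhat ω) ω) P :=
    integrable_finsetSum _ fun i _ => integrable_soft_loss hym hyL θ hlm hmem i
  have hrisk : ∀ l ∈ Set.Icc 0 Λ, ∫ ω, softLoss θ l (X ω) ∂P = ∫ ω, loss l ω ∂P := fun l hl => by
    simp_rw [hlossY l hl.1]; rfl
  refine ⟨hhatI.congr hhat.symm, fun l hl => ?_, ?_⟩
  · simp_rw [hlossY l hl.1]
    exact integrable_finsetSum _ fun i _ => hlossI l hl i
  obtain ⟨l₀, hl₀, hmin₀⟩ := isCompact_Icc.exists_isMinOn (Set.nonempty_Icc.2 hΛ0)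
    (continuousOn_soft_risk (P := P) hym hyL θ Λ)
  refine ⟨∫ ω, loss l₀ ω ∂P, ⟨⟨l₀, hl₀, hrisk l₀ hl₀⟩, ?_⟩, ?_⟩
  · rintro _ ⟨l, hl, rfl⟩
    simp only [hrisk l hl]
    exact hmin₀ hl
  rw [integral_congr_ae hhat]
  have hR0 : 0 ≤ ∫ ω, loss l₀ ω ∂P := integral_nonneg fun ω =>
    Finset.sum_nonneg fun i _ => sq_nonneg _
  -- In dimension one `log d = 0`: the range is `{0}`, both thresholds coincide and the remainder
  -- vanishes. For `d ≥ 2` the logarithm is bounded away from zero.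
  rcases hd.eq_or_lt with rfl | hd2
  · have hΛz : Λ = 0 := by simp [hΛ]
    have hl0 : l₀ = 0 := le_antisymm (hΛz ▸ hl₀.2) hl₀.1
    have h1 : ∫ ω, loss (lhat ω) ω ∂P = ∫ ω, loss l₀ ω ∂P := by
      refine integral_congr_ae (hmem.mono fun ω h => ?_)
      have h2 : lhat ω = l₀ := by rw [hl0]; exact le_antisymm (hΛz ▸ h.2) h.1
      simp only [h2]
    rw [h1]
    simp only [Nat.cast_one, Real.log_one]
    norm_num
    nlinarith
  -- the bias of the risk estimate
  have hsur : ∀ l ∈ Set.Icc 0 Λ, ∀ ω, softSure σ l (X ω) =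
      d * σ ^ 2 + ∑ i, min ((θ i + y i ω) ^ 2) (l ^ 2) -
      2 * σ ^ 2 * ∑ i, (if |θ i + y i ω| ≤ l then (1 : ℝ) else 0) := fun l hl ω => by
    rw [softSure_eq σ l hl.1]
    simp [hXi]
  have hbias : ∀ l ∈ Set.Icc 0 Λ, |∫ ω, (d * σ ^ 2 + ∑ i, min ((θ i + y i ω) ^ 2) (l ^ 2) -
      2 * σ ^ 2 * ∑ i, (if |θ i + y i ω| ≤ l then (1 : ℝ) else 0)) ∂P - ∫ ω, loss l ω ∂P| ≤
      2 * (L * M) * ∫ ω, loss l ω ∂P := by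
    intro l hl
    have hAm : ∀ i, Measurable fun ω => |θ i + y i ω| := fun i =>
      continuous_abs.measurable.comp ((hym i).const_add _)
    have hcm : ∀ i, Measurable fun ω => clip l (θ i + y i ω) := fun i =>
      (measurable_clip l).comp ((hym i).const_add _)
    have i1 : ∀ i, Integrable (fun ω => y i ω * clip l (θ i + y i ω)) P := fun i =>
      ((hyL i).integrable (by norm_num)).mul_bdd (c := l) (hcm i).aestronglyMeasurable
        (ae_of_all _ fun ω => abs_clip_le hl.1 _)
    have i2 : ∀ i, Integrable (fun ω => if |θ i + y i ω| ≤ l then (1 : ℝ) else 0) P := fun i =>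
      integrable_ite_le (hAm i) l
    have i3 : ∀ i, Integrable (fun ω => y i ω ^ 2) P := fun i => (hyL i).integrable_sq
    have hcoord : ∀ i, |∫ ω, y i ω * clip l (θ i + y i ω) ∂P -
        σ ^ 2 * ∫ ω, (if |θ i + y i ω| ≤ l then (1 : ℝ) else 0) ∂P| ≤
        L * M * ∫ ω, (y i ω - clip l (θ i + y i ω)) ^ 2 ∂P := fun i => by
      have h1 := hT.abs_clip_bias_le i (hν2 i) (hνvar i) (hTL'.mono fun z hz => hz i) (θ i) hl.1
      have hxm : Measurable fun z : EuclideanSpace ℝ (Fin d) => θ i + z i :=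
        (measurable_coord i).const_add _
      have hcm' : Measurable fun z : EuclideanSpace ℝ (Fin d) => z i * clip l (θ i + z i) :=
        (measurable_coord i).mul ((measurable_clip l).comp hxm)
      have hxa : Measurable fun z : EuclideanSpace ℝ (Fin d) => |θ i + z i| :=
        continuous_abs.measurable.comp hxm
      rw [integral_map hYm.aemeasurable hcm'.aestronglyMeasurable,
        integral_map hYm.aemeasurable (measurable_ite_le hxa l).aestronglyMeasurable,
        ← hmap] at h1
      refine h1.trans ?_
      rw [mul_assoc]
      refine mul_le_mul_of_nonneg_left ((hratio l hl i).trans ?_) hL0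
      exact mul_le_mul_of_nonneg_left
        (measureReal_lt_le_soft_risk (hym i) hl.1 (hθA i) (hlossI l hl i)) hM0
    -- The terms `min(x_i², l²)` cancel and `σ² - y_i²` has mean zero, which leaves twice the Stein
    -- discrepancy of `clip`.
    have hsum : ∫ ω, (d * σ ^ 2 + ∑ i, min ((θ i + y i ω) ^ 2) (l ^ 2) -
        2 * σ ^ 2 * ∑ i, (if |θ i + y i ω| ≤ l then (1 : ℝ) else 0)) ∂P - ∫ ω, loss l ω ∂P =
        2 * ∑ i, (∫ ω, y i ω * clip l (θ i + y i ω) ∂P -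
          σ ^ 2 * ∫ ω, (if |θ i + y i ω| ≤ l then (1 : ℝ) else 0) ∂P) := by
      have i4 : ∀ i, Integrable (fun ω => min ((θ i + y i ω) ^ 2) (l ^ 2)) P := fun i =>
        (integrable_const (l ^ 2)).mono'
          ((((hym i).const_add _).pow_const 2).min measurable_const).aestronglyMeasurable
          (ae_of_all _ fun ω => by
            rw [Real.norm_of_nonneg (le_min (sq_nonneg _) (sq_nonneg _))]
            exact min_le_right _ _)
      have i5 : ∀ i, Integrable (fun ω => 2 * (y i ω * clip l (θ i + y i ω)) -
          2 * σ ^ 2 * (if |θ i + y i ω| ≤ l then (1 : ℝ) else 0)) P := fun i =>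
        ((i1 i).const_mul 2).sub ((i2 i).const_mul _)
      have i6 : ∀ i, Integrable (fun ω => σ ^ 2 - y i ω ^ 2) P := fun i =>
        (integrable_const _).sub (i3 i)
      have i7 : Integrable (fun ω => d * σ ^ 2 + ∑ i, min ((θ i + y i ω) ^ 2) (l ^ 2) -
          2 * σ ^ 2 * ∑ i, (if |θ i + y i ω| ≤ l then (1 : ℝ) else 0)) P :=
        ((integrable_const _).add (integrable_finsetSum _ fun i _ => i4 i)).sub
          ((integrable_finsetSum _ fun i _ => i2 i).const_mul _)
      rw [← integral_sub i7 (integrable_finsetSum _ fun i _ => hlossI l hl i)]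
      have e1 : ∀ ω, d * σ ^ 2 + ∑ i, min ((θ i + y i ω) ^ 2) (l ^ 2) -
          2 * σ ^ 2 * ∑ i, (if |θ i + y i ω| ≤ l then (1 : ℝ) else 0) - loss l ω =
          ∑ i, ((2 * (y i ω * clip l (θ i + y i ω)) -
          2 * σ ^ 2 * (if |θ i + y i ω| ≤ l then (1 : ℝ) else 0)) + (σ ^ 2 - y i ω ^ 2)) := by
        intro ω
        have e2 : (d : ℝ) * σ ^ 2 = ∑ _i : Fin d, σ ^ 2 := by simp
        rw [e2]
        simp only [hloss, Finset.mul_sum, ← Finset.sum_add_distrib, ← Finset.sum_sub_distrib]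
        refine Finset.sum_congr rfl fun i _ => ?_
        rw [← clip_sq hl.1]
        ring
      refine (integral_congr_ae (ae_of_all _ e1)).trans ?_
      rw [integral_finsetSum Finset.univ (f := fun i ω =>
        (2 * (y i ω * clip l (θ i + y i ω)) -
          2 * σ ^ 2 * (if |θ i + y i ω| ≤ l then (1 : ℝ) else 0)) + (σ ^ 2 - y i ω ^ 2))
        fun i _ => (i5 i).add (i6 i), Finset.mul_sum]
      refine Finset.sum_congr rfl fun i _ => ?_
      rw [integral_add (i5 i) (i6 i), integral_sub ((i1 i).const_mul 2) ((i2 i).const_mul _),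
        integral_sub (integrable_const _) (i3 i), hvar]
      simp only [integral_const_mul, integral_const, probReal_univ, smul_eq_mul]
      ring
    rw [hsum, abs_mul, abs_two, mul_assoc]
    refine mul_le_mul_of_nonneg_left ((Finset.abs_sum_le_sum_abs _ _).trans ?_) (by norm_num)
    rw [integral_finsetSum _ fun i _ => hlossI l hl i, Finset.mul_sum]
    exact Finset.sum_le_sum fun i _ => hcoord i
  have hσK : σ ^ 2 ≤ C + 1 / 2 := by
    have i : Fin d := ⟨0, hd⟩
    have h1 := hT.le_of_integrable_exp_sq i hC
      ((integrable_map_measure (by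
        have := measurable_coord i
        fun_prop) hYm.aemeasurable).2 (hexp i))
      (hTL'.mono fun z hz => hz i)
    linarith
  have hlog : 0 ≤ Real.log d := Real.log_natCast_nonneg d
  have hatom : ∀ i c, P {ω | |θ i + y i ω| = c} = 0 := fun i c => by
    have h1 := measure_abs_coord_eq_zero hac i (θ i) c
    have hxa : Measurable fun z : EuclideanSpace ℝ (Fin d) => |θ i + z i| :=
      continuous_abs.measurable.comp ((measurable_coord i).const_add _)
    rwa [Measure.map_apply hYm (measurableSet_eq_fun hxa measurable_const)] at h1
  have hmain := soft_oracle_inequality (P := P) hd2 hym hyL hindep hvar hσK hatom hΛ0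
    (Real.sq_sqrt (by positivity)) (b := 2 * (L * M)) (by positivity) (by linarith)
    (loss := loss) (fun _ _ => rfl) (fun _ _ => rfl) hbias hmem hl₀
    (by
      filter_upwards [hlhat] with ω hω
      have h1 := hω.2 hl₀
      simp only [Set.mem_ofPred_eq] at h1
      rwa [hsur _ hω.1, hsur _ hl₀] at h1) hhatI
  obtain ⟨b1, b2⟩ := sqrt_mul_log_cube_bounds hd2
  set S := Real.sqrt (d * Real.log d ^ 3)
  have b3 : (1 : ℝ) ≤ Real.sqrt d := by
    rw [Real.one_le_sqrt]; exact_mod_cast hd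
  refine hmain.trans ?_
  have c1 := mul_le_mul_of_nonneg_left b2 hC.le
  have c2 := mul_le_mul_of_nonneg_left b1 (by positivity : 0 ≤ C + 1 / 2)
  have c3 := mul_le_mul_of_nonneg_left b2 (by positivity : 0 ≤ C + 1 / 2)
  have c4 := mul_le_mul_of_nonneg_left b3 (by positivity : 0 ≤ C + 1 / 2)
  linarith
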